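/- **Setting.** Let $d\ge 4$, $R>0$, and let $\Phi\in\mathcal C^3(\mathbb R^d,\mathbb R)$ be even with support in the closed ball $\mathcal B(0,R)$. Fix $\eta\ge 2$. For $N\in\mathbb N$ let $\mathbb T=\mathbb R^d/(2N^\eta\mathbb Z)^d$ (identified with $[-N^\eta,N^\eta)^d$). A tagged particle $(X_t,V_t)$ and $\mathcal N$ background particles $(x^i_t,v^i_t)_{1\le i\le\mathcal N}$ in $\mathbb T\times\mathbb R^d$ evolve, for $t\in\mathbb R$, by $$\dot X_t=V_t,\quad \dot V_t=-\frac1N\sum_{i}\nabla\Phi(X_t-x^i_t),\qquad \dot x^i_t=v^i_t,\quad \dot v^i_t=\frac1N\nabla\Phi(X_t-x^i_t).$$ With $\gamma$ the standard Gaussian density on $\mathbb R^d$, the initial configuration is distributed by the grand canonical law $$\mathbb E[F]=\frac1{\mathcal Z}\sum_{n\ge0}\frac{N^n}{n!}\int_{\mathbb T\times\mathbb R^d}\!dX\,dV\int_{(\mathbb T\times\mathbb R^d)^n}\!\prod_{i=1}^n dx_i\,dv_i\; e^{-\frac1N\sum_{i}\Phi(X-x_i)}\gamma(V)\prod_{i=1}^n\gamma(v_i)\,F,$$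 with $\mathcal Z$ the normalizing constant. Put $\hat{\mathbb E}[f]=\mathbb E[\frac{\mathcal N}{N}f]$, where $f$ may single out background particle $1$, and $\hat{\mathbb E}_{\mathcal G}[f]=\hat{\mathbb E}[f\mathbf 1_{\mathcal G}]$. **Good and better sets.** Let $C_{int},K$ be constants and $M_N\ge0$ a sequence. For a multi-index $\mathcal I\in\{1,\dots,d\}^{|\mathcal I|}$, $\partial_{\mathcal I}$ is the corresponding partial derivative. The *good set* $\mathcal G_N(\delta)$ is the set of initial configurations with $\mathcal N>1$ such that for all $t\in[-2N,2N]$: - $|V_t|<N^{1/2}$ and $|v^i_t|<N^{1/2}$ for all $i$; - $\sum_i\mathbf 1_{|x^i_t-X_t|\le R}\le C_{int}N$; - $\big|\frac1{\sqrt N}\sum_i\partial_{\mathcal I}\Phi(X_t-x^i_t)\big|^2\le N^\delta$ and $\big|\frac1N\sum_i\partial_{\mathcal I}\Phi(X_t-x^i_t)\mathbf 1_{|v^i_t-V_t|\ge M_N}\big|\le K N^{-\frac{1-\delta}2}$ for all $\mathcal I$ with $1\le|\mathcal I|\le4$ (orders for which $\Phi$ is of class $\mathcal C^{|\mathcal I|}$);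 - $\sum_i\big(|v^i_t-V_t|^{-1}\wedge N^{1/3}\big)^k\mathbf 1_{|x^i_t-X_t|\le R}\le K N^{1+\delta}$ for $k\in\{1,2,3\}$, and $\le K N^{\frac k3+\delta}$ for $k\in\{4,5,6\}$. The *better set* $\mathcal G_N(\delta,\alpha,\beta)$ is the set of those configurations in $\mathcal G_N(\delta)$ such that for all $s,t\in[-2N,2N]$ with $|t-s|\le N^\beta$ and all $\mathcal I$ with $1\le|\mathcal I|\le3$, $$\Big|\frac1N\int_s^t\sum_i\partial_{\mathcal I}\Phi(X_u-x^i_u)\,du\Big|\le K\sqrt{\tfrac{|t-s|}N}\,N^\alpha,\qquad \Big|\frac1N\int_s^t\sum_i\partial_{\mathcal I}\Phi(X_u-x^i_u)\mathbf 1_{|v^i_u-V_u|\ge M_N}\,du\Big|\le K\sqrt{\tfrac{|t-s|}N}\,N^\alpha .$$ **Proposition.** Set $$\gamma_r=\frac14+\frac1{36},\qquad \alpha^*=\frac1{4(d+2)}+\delta,\qquad \beta^*=\frac{2d^2+5d+4}{2(d+2)(d+4)}-\delta,$$ and let $C^1_t$ be the recollision event $$C^1_t=\Big\{\exists s\in[0,N]:\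 |s-t|\ge\tfrac{6R}{|v^1_t-V_t|},\ |x^1_s-X_s|\le R\Big\}\cap\big\{|x^1_t-X_t|\le R\big\}.$$ There are $\delta_0>0$ and $C>0$, depending only on $d,R,\Phi,C_{int},K$, such that for every $\eta\ge2$ and every $\delta\in(0,\delta_0)$ one has $-\frac{19}{18}+2(d-1)\delta<-1$, and there is $N_0$ such that for every sequence $(M_N)\ge0$, every $N\ge N_0$ and every $t\in[-N,N]$, $$\hat{\mathbb E}_{\mathcal G_N(\delta,\alpha^*,\beta^*)}\Big[\mathbf 1_{C^1_t}\mathbf 1_{|v^1_t-V_t|\ge N^{-\gamma_r}}\Big]\le C\,N^{-\frac{19}{18}+2(d-1)\delta}.$$ In particular this quantity is $o(1/N)$. -/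

import Mathlib

open MeasureTheory
open scoped ENNReal

namespace TaggedParticle

/-- Euclidean space `ℝ^d`. -/
abbrev E (d : ℕ) : Type := EuclideanSpace ℝ (Fin d)

/-- Position and velocity of one particle.  Positions on the torus `𝕋 = ℝ^d / (2 N^η ℤ)^d` are
represented by points of `ℝ^d`; the interaction only sees them modulo the period (see `wrap`). -/
abbrev Phase (d : ℕ) : Type := E d × E d

/-- The tagged particle `Z = (X, V)` together with `M` background particles `z_i = (x_i, v_i)`;
the background particle called "particle 1" has index `0`. -/
abbrev Config (d M : ℕ) : Type := Phase d × (Fin M → Phase d)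

/-- Grand canonical configurations `(𝒩, Z, z_{1:𝒩})`, with `𝒩 = ω.1`. -/
abbrev GrandConfig (d : ℕ) : Type := Σ M : ℕ, Config d M

/-- Half the side length `N^η` of the torus `𝕋 = [-N^η, N^η]^d`. -/
noncomputable def halfSide (N : ℕ) (η : ℝ) : ℝ := (N : ℝ) ^ η

/-- Representative in `[-L, L)^d` of the class of `y` in the torus `ℝ^d / (2 L ℤ)^d`.  Its norm is
the distance to `0` on the torus. -/
noncomputable def wrap {d : ℕ} (L : ℝ) (y : E d) : E d :=
  WithLp.toLp 2 fun j => y j - 2 * L * round (y j / (2 * L))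

/-- The relative position `X - x_i`, on the torus. -/
noncomputable def relPos {d M : ℕ} (L : ℝ) (c : Config d M) (i : Fin M) : E d :=
  wrap L (c.1.1 - (c.2 i).1)

/-- The relative speed `|v_i - V|`. -/
noncomputable def relSpeed {d M : ℕ} (c : Config d M) (i : Fin M) : ℝ :=
  ‖(c.2 i).2 - c.1.2‖

/-! ### Dynamics -/

/-- The right hand side of Newton's equations
`X' = V`, `V' = -(1/N) ∑ i, ∇Φ (X - x_i)`, `x_i' = v_i`, `v_i' = (1/N) ∇Φ (X - x_i)`. -/
noncomputable def newtonField {d M : ℕ} (N : ℕ) (η : ℝ) (Φ : E d → ℝ) (c : Config d M) :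
    Config d M :=
  ((c.1.2, -((N : ℝ)⁻¹ • ∑ i, gradient Φ (relPos (halfSide N η) c i))),
    fun i => ((c.2 i).2, (N : ℝ)⁻¹ • gradient Φ (relPos (halfSide N η) c i)))

/-- `γ` is a trajectory, defined for all (positive and negative) times, started from `c`. -/
def IsTrajectory {d M : ℕ} (N : ℕ) (η : ℝ) (Φ : E d → ℝ) (c : Config d M) (γ : ℝ → Config d M) :
    Prop :=
  γ 0 = c ∧ ∀ t, HasDerivAt γ (newtonField N η Φ (γ t)) t

open scoped Classical in
/-- The configuration at time `t` when the configuration at time `0` is `c`.  When `Φ` is `C^2` and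
is supported in a ball of radius smaller than `N^η`, `newtonField` is globally Lipschitz, so that
there is exactly one trajectory started from `c`; the default value is then never used. -/
noncomputable def flow {d M : ℕ} (N : ℕ) (η : ℝ) (Φ : E d → ℝ) (c : Config d M) :
    ℝ → Config d M :=
  if h : ∃ γ, IsTrajectory N η Φ c γ then h.choose else fun _ => c

/-! ### The grand canonical measure -/

/-- The density `γ` of the standard normal distribution on `ℝ^d`. -/
noncomputable def gaussianDensity {d : ℕ} (v : E d) : ℝ :=
  (2 * Real.pi) ^ (-(d : ℝ) / 2) * Real.exp (-‖v‖ ^ 2 / 2)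

/-- The fundamental domain `[-L, L)^d` of the torus. -/
def cube (d : ℕ) (L : ℝ) : Set (E d) := {x | ∀ j, x j ∈ Set.Ico (-L) L}

/-- Lebesgue measure on `𝕋 × ℝ^d`. -/
noncomputable def phaseVolume (d : ℕ) (L : ℝ) : Measure (Phase d) :=
  ((volume : Measure (E d)).restrict (cube d L)).prod (volume : Measure (E d))

/-- The equilibrium density
`ρ_M = exp (-(1/N) ∑ i, Φ (X - x_i)) γ(V) ∏ i, γ(v_i)`. -/
noncomputable def gibbsDensity {d M : ℕ} (N : ℕ) (η : ℝ) (Φ : E d → ℝ) (c : Config d M) : ℝ :=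
  Real.exp (-((N : ℝ)⁻¹ * ∑ i, Φ (relPos (halfSide N η) c i))) * gaussianDensity c.1.2 *
    ∏ i, gaussianDensity (c.2 i).2

/-- The measure `ρ_M dZ dz_{1:M}`. -/
noncomputable def gibbsMeasure {d : ℕ} (N : ℕ) (η : ℝ) (Φ : E d → ℝ) (M : ℕ) :
    Measure (Config d M) :=
  ((phaseVolume d (halfSide N η)).prod
    (Measure.pi fun _ : Fin M => phaseVolume d (halfSide N η))).withDensity
      fun c => ENNReal.ofReal (gibbsDensity N η Φ c)

/-- `∑ M, N^M / M! ρ_M dZ dz_{1:M}`, the grand canonical measure before normalization. -/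
noncomputable def unnormalizedMeasure {d : ℕ} (N : ℕ) (η : ℝ) (Φ : E d → ℝ) :
    Measure (GrandConfig d) :=
  Measure.sum fun M : ℕ =>
    ((N : ℝ≥0∞) ^ M / (M.factorial : ℝ≥0∞)) •
      (gibbsMeasure N η Φ M).map (fun c : Config d M => (⟨M, c⟩ : GrandConfig d))

/-- The grand canonical probability measure `ℙ`. -/
noncomputable def grandCanonical {d : ℕ} (N : ℕ) (η : ℝ) (Φ : E d → ℝ) :
    Measure (GrandConfig d) :=
  (unnormalizedMeasure N η Φ Set.univ)⁻¹ • unnormalizedMeasure N η Φ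

/-- The measure `(𝒩 / N) dℙ`.  Integration against it is the non-symmetric expectation
`Ê[f] = 𝔼[(𝒩 / N) f]`; in particular its value on a set `S` is `Ê[1_S]`. -/
noncomputable def hatMeasure {d : ℕ} (N : ℕ) (η : ℝ) (Φ : E d → ℝ) : Measure (GrandConfig d) :=
  (grandCanonical N η Φ).withDensity fun ω => (ω.1 : ℝ≥0∞) / (N : ℝ≥0∞)

/-! ### The good set and the better set -/

/-- The partial derivative `∂_I Φ (x)` for a multi-index `I ∈ {1, …, d}^k`. -/
noncomputable def partialDeriv {d k : ℕ} (I : Fin k → Fin d) (Φ : E d → ℝ) (x : E d) : ℝ :=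
  iteratedFDeriv ℝ k Φ x fun j => EuclideanSpace.single (I j) (1 : ℝ)

/-- `∑ i, ∂_I Φ (X - x_i)`. -/
noncomputable def derivSum {d M k : ℕ} (L : ℝ) (Φ : E d → ℝ) (I : Fin k → Fin d)
    (c : Config d M) : ℝ :=
  ∑ i, partialDeriv I Φ (relPos L c i)

/-- `∑ i, ∂_I Φ (X - x_i) 1_{|v_i - V| ≥ m}`. -/
noncomputable def fastDerivSum {d M k : ℕ} (L : ℝ) (Φ : E d → ℝ) (I : Fin k → Fin d) (m : ℝ)
    (c : Config d M) : ℝ :=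
  ∑ i, {i | m ≤ relSpeed c i}.indicator (fun i => partialDeriv I Φ (relPos L c i)) i

/-- The truncated interaction time `min (1 / |v_i - V|) N^(1/3)`, which is `N^(1/3)` when
`v_i = V`. -/
noncomputable def truncTime {d M : ℕ} (N : ℕ) (c : Config d M) (i : Fin M) : ℝ :=
  (max (relSpeed c i) ((N : ℝ) ^ (-(1 / 3) : ℝ)))⁻¹

/-- The controls which define the good set, for the configuration at one time.  Here `Cint` is the
constant of the bound on the number of interacting particles, `K` is the implicit constant in the
bounds of the form `O(…)`, and `m` is the velocity threshold `M_N`.  The derivatives of order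
`k ∈ {1, 2, 3, 4}` are considered as long as `Φ` is of class `C^k`. -/
structure IsGoodAt {d M : ℕ} (N : ℕ) (η R : ℝ) (Φ : E d → ℝ) (Cint K m δ : ℝ)
    (c : Config d M) : Prop where
  tagged_speed : ‖c.1.2‖ < (N : ℝ) ^ (1 / 2 : ℝ)
  background_speed : ∀ i, ‖(c.2 i).2‖ < (N : ℝ) ^ (1 / 2 : ℝ)
  interacting : ∑ i, {i | ‖relPos (halfSide N η) c i‖ ≤ R}.indicator (fun _ => (1 : ℝ)) i
    ≤ Cint * N
  force : ∀ k : ℕ, 1 ≤ k → k ≤ 4 → ContDiff ℝ k Φ → ∀ I : Fin k → Fin d,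
    |1 / Real.sqrt N * derivSum (halfSide N η) Φ I c| ^ 2 ≤ (N : ℝ) ^ δ
  interaction_time_small : ∀ k : ℕ, 1 ≤ k → k ≤ 3 →
    ∑ i, {i | ‖relPos (halfSide N η) c i‖ ≤ R}.indicator (fun i => truncTime N c i ^ k) i
      ≤ K * (N : ℝ) ^ (1 + δ)
  interaction_time_large : ∀ k : ℕ, 3 < k → k ≤ 6 →
    ∑ i, {i | ‖relPos (halfSide N η) c i‖ ≤ R}.indicator (fun i => truncTime N c i ^ k) i
      ≤ K * (N : ℝ) ^ ((k : ℝ) / 3 + δ)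
  fast_force : ∀ k : ℕ, 1 ≤ k → k ≤ 4 → ContDiff ℝ k Φ → ∀ I : Fin k → Fin d,
    |1 / (N : ℝ) * fastDerivSum (halfSide N η) Φ I m c| ≤ K * (1 / (N : ℝ) ^ ((1 - δ) / 2))

/-- The good set `𝒢_N(δ)`. -/
def goodSet {d : ℕ} (N : ℕ) (η R : ℝ) (Φ : E d → ℝ) (Cint K m δ : ℝ) : Set (GrandConfig d) :=
  {ω | 1 < ω.1 ∧ ∀ t ∈ Set.Icc (-(2 * N : ℝ)) (2 * N),
    IsGoodAt N η R Φ Cint K m δ (flow N η Φ ω.2 t)}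

/-- The better set `𝒢_N(δ, α, β)`.  The bounds on `|V_t - V_s|` and on the integrals of the gradient
and of the Hessian follow, up to a dimensional constant, from the cases `k = 1` and `k = 2` of the first bound. -/
def betterSet {d : ℕ} (N : ℕ) (η R : ℝ) (Φ : E d → ℝ) (Cint K m δ α β : ℝ) :
    Set (GrandConfig d) :=
  {ω | ω ∈ goodSet N η R Φ Cint K m δ ∧
    ∀ s ∈ Set.Icc (-(2 * N : ℝ)) (2 * N), ∀ t ∈ Set.Icc (-(2 * N : ℝ)) (2 * N),
      |t - s| ≤ (N : ℝ) ^ β → ∀ k : ℕ, 1 ≤ k → k ≤ 3 → ∀ I : Fin k → Fin d,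
        |1 / (N : ℝ) * ∫ u in s..t, derivSum (halfSide N η) Φ I (flow N η Φ ω.2 u)|
            ≤ K * (Real.sqrt (|t - s| / N) * (N : ℝ) ^ α) ∧
        |1 / (N : ℝ) * ∫ u in s..t, fastDerivSum (halfSide N η) Φ I m (flow N η Φ ω.2 u)|
            ≤ K * (Real.sqrt (|t - s| / N) * (N : ℝ) ^ α)}

/-- `α* = 1 / (4 (d + 2)) + δ`. -/
noncomputable def alphaStar (d : ℕ) (δ : ℝ) : ℝ := 1 / (4 * ((d : ℝ) + 2)) + δ

/-- `β* = (2 d² + 5 d + 4) / (2 (d + 2) (d + 4)) - δ`. -/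
noncomputable def betaStar (d : ℕ) (δ : ℝ) : ℝ :=
  (2 * (d : ℝ) ^ 2 + 5 * d + 4) / (2 * ((d : ℝ) + 2) * ((d : ℝ) + 4)) - δ

/-- `γ_r = 1/4 + 1/36`. -/
noncomputable def gammaR : ℝ := 1 / 4 + 1 / 36

/-! ### The recollision event -/

/-- The recollision event `C^1_t`: particle 1 is in the interaction ball at time `t`, and again at
some time `s ∈ [0, N]` with `|s - t| ≥ 6 R / |v^1_t - V_t|`. -/
def recollision {d : ℕ} (N : ℕ) (η R : ℝ) (Φ : E d → ℝ) (t : ℝ) : Set (GrandConfig d) :=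
  {ω | ∃ h : 0 < ω.1,
    (∃ s ∈ Set.Icc (0 : ℝ) N,
      6 * R / relSpeed (flow N η Φ ω.2 t) ⟨0, h⟩ ≤ |s - t| ∧
      ‖relPos (halfSide N η) (flow N η Φ ω.2 s) ⟨0, h⟩‖ ≤ R) ∧
    ‖relPos (halfSide N η) (flow N η Φ ω.2 t) ⟨0, h⟩‖ ≤ R}

/-- The event `|v^1_t - V_t| ≥ r`. -/
def fastAt {d : ℕ} (N : ℕ) (η : ℝ) (Φ : E d → ℝ) (r t : ℝ) : Set (GrandConfig d) :=
  {ω | ∃ h : 0 < ω.1, r ≤ relSpeed (flow N η Φ ω.2 t) ⟨0, h⟩}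

end TaggedParticle

open TaggedParticle

/-!
Suppose that the background particle 1 is in the interaction ball of the tagged particle at time
`t`, with relative speed between `2 ^ k g` and `2 ^ (k + 1) g`, where `g = N ^ (-5 / 18)`, and that
it is there again at a time `s` with `|s - t| ≥ 6 R / |v - V|`.  After the time
`τ = 3 R / (2 ^ k g)` in the direction of `s`, particle 1 has left the ball, and by the bounds
of the better set it has done so with almost its initial relative velocity
(`norm_relVel_sub_le`).  Until it comes back it moves freely, while the tagged particle and the
other background particles follow the dynamics in which particle 1 is absent
(`mem_freeRecollision_of_return`).  So the configuration at time `t ± τ` lies in a set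
`freeRecollision`, in which the motion of particle 1 is independent of the remaining dynamics, and
the Gibbs measure of this set does not depend on `t ± τ`.

The measure of `freeRecollision` is estimated with the Mecke formula: under `hatMeasure`, and up to
the factor `exp b` with `b ≥ sup |Φ|`, particle 1 is distributed by the Lebesgue measure times the
Gaussian, independently of the rest (`hatMeasure_le`).  For a given trajectory `X` of the rest, a
particle starting at `x` near `X_0` is close to `X_s` at time `s ≥ a` only if its velocity is within
a multiple of `R / s` of `(X_s - x) / s`.  With times on a grid of step `h`, the volume of these
velocities is at most a multiple of `∑ (a + j h) ^ (-d)`, that is, of `h⁻¹ a ^ (-(d - 1))`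
(`hatMeasure_freeRecollision_le`).  Winding around the torus does not occur before time
`2 N`, since all speeds are below `N ^ (1 / 2)` and `η ≥ 2`.

For slow particles, of initial relative speed below one, the relative velocity changes by less than
`g / 10` up to the time `a = e ^ 2 N ^ (4 / 9 - 2 α*)`, so that no recollision is possible before.
Up to the time `N ^ (5 / 9)` the relative speed stays of order one, and a grid of constant step is
enough.  Fast particles cannot recollide before `N ^ (5 / 9)`.  For recollisions after
`N ^ (5 / 9)`, of slow or fast particles, a grid with step of order `N ^ (-1 / 2)` is used, since
only the bound `N ^ (1 / 2)` on the speeds is available (`recollision_subset`).  The two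
contributions are at most `N ^ (-13 / 12 + 2 (d - 1) δ)`, up to constants, and the `O(log N)`
dyadic scales `k` cost at most `N ^ (1 / 36)`.

The invariance of the Gibbs measure under the flow is Liouville's theorem together with the
conservation of energy.  Newton's equations are of second order, with an acceleration which
depends on the positions only; the flow is a limit of compositions of drifts
and kicks, which are shears and preserve the Lebesgue measure
(`measurePreserving_flow`, `gibbsMeasure_preimage_flow`, `hatMeasure_preimage_flow`).  Since
positions are represented by points of `ℝ ^ d`, the passage to the torus uses that two fundamental
domains of a lattice give the same measure to a periodic set.
-/

open MeasureTheory
open scoped ENNReal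

namespace TaggedParticle

open scoped NNReal Manifold

/-! ### Global solutions of Lipschitz equations -/

/-- A `C^1` vector field which is globally Lipschitz has global solutions: Picard–Lindelöf gives a
solution on a time interval whose length does not depend on the starting point, and such local
solutions can be concatenated. -/
theorem exists_global_solution {W : Type*} [NormedAddCommGroup W] [NormedSpace ℝ W]
    [CompleteSpace W] {v : W → W} (hv : ContDiff ℝ 1 v) {K : ℝ≥0} (hK : LipschitzWith K v)
    (c : W) : ∃ γ : ℝ → W, γ 0 = c ∧ ∀ t, HasDerivAt γ (v (γ t)) t := by
  have key := exists_isMIntegralCurve_of_isMIntegralCurveOn (I := 𝓘(ℝ, W)) (M := W) (v := v)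
    (contMDiff_vectorSpace_iff_contDiff.2 hv) (ε := 1 / (2 * (K + 1))) (by positivity) ?_ c
  · obtain ⟨γ, h0, hγ⟩ := key
    refine ⟨γ, h0, fun t => ?_⟩
    have h : HasFDerivAt γ (ContinuousLinearMap.toSpanSingleton ℝ (v (γ t)) : ℝ →L[ℝ] W) t :=
      hasMFDerivAt_iff_hasFDerivAt.1 (hγ t)
    exact h.hasDerivAt.congr_deriv (by simp)
  · intro x
    have hε : (0 : ℝ) < 1 / (2 * (K + 1)) := by positivity
    have hpl : IsPicardLindelof (fun _ => v) (tmin := -(1 / (2 * ((K : ℝ) + 1))))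
        (tmax := 1 / (2 * ((K : ℝ) + 1))) ⟨0, by constructor <;> linarith⟩ x
        (‖v x‖₊ + 1) 0 ((K + 1) * (‖v x‖₊ + 1)) K := by
      refine IsPicardLindelof.of_time_independent (fun y hy => ?_) hK.lipschitzOnWith ?_
      · have h1 : ‖v y - v x‖ ≤ K * ‖y - x‖ := hK.norm_sub_le y x
        have h2 : ‖y - x‖ ≤ ‖v x‖ + 1 := by simpa [dist_eq_norm] using hy
        have h3 : ‖v y‖ ≤ ‖v x‖ + ‖v y - v x‖ := norm_le_norm_add_norm_sub' _ _
        have h4 : (K : ℝ) * ‖y - x‖ ≤ K * (‖v x‖ + 1) := by gcongr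
        push_cast
        linarith
      · push_cast
        simp only [sub_zero, zero_sub, neg_neg, max_self]
        have : ((K : ℝ) + 1) * (‖v x‖ + 1) * (1 / (2 * (K + 1))) = (‖v x‖ + 1) / 2 := by
          field_simp
        rw [this]
        linarith [norm_nonneg (v x)]
    obtain ⟨α, h0, hα⟩ := hpl.exists_eq_forall_mem_Icc_hasDerivWithinAt₀
    refine ⟨α, h0, fun t ht => ?_⟩
    have := (hα t ⟨ht.1.le, ht.2.le⟩).hasDerivAt (Icc_mem_nhds ht.1 ht.2)
    exact (hasMFDerivAt_iff_hasFDerivAt.2 this.hasFDerivAt).hasMFDerivWithinAt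

/-! ### Functions on the torus -/

/-- The vector of the period lattice `(2 L ℤ)^d` with integer coordinates `m`. -/
noncomputable def latticeVec {d : ℕ} (L : ℝ) (m : Fin d → ℤ) : E d :=
  WithLp.toLp 2 fun j => 2 * L * m j

@[simp] theorem latticeVec_apply {d : ℕ} (L : ℝ) (m : Fin d → ℤ) (j : Fin d) :
    latticeVec L m j = 2 * L * m j := rfl

@[simp] theorem wrap_apply {d : ℕ} (L : ℝ) (y : E d) (j : Fin d) :
    wrap L y j = y j - 2 * L * round (y j / (2 * L)) := rfl

theorem wrap_eq_sub_latticeVec {d : ℕ} (L : ℝ) (y : E d) :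
    wrap L y = y - latticeVec L fun j => round (y j / (2 * L)) := by
  ext j; simp

theorem abs_coord_le_norm {d : ℕ} (y : E d) (j : Fin d) : |y j| ≤ ‖y‖ :=
  PiLp.norm_apply_le y j

theorem wrap_add_latticeVec {d : ℕ} {L : ℝ} (hL : 0 < L) (y : E d) (m : Fin d → ℤ) :
    wrap L (y + latticeVec L m) = wrap L y := by
  ext j
  have : (y j + 2 * L * m j) / (2 * L) = y j / (2 * L) + m j := by field_simp
  simp only [wrap_apply, PiLp.add_apply, latticeVec_apply, this, round_add_intCast]
  push_cast; ring

theorem wrap_eq_self {d : ℕ} {L : ℝ} (hL : 0 < L) {y : E d} (hy : ‖y‖ < L) : wrap L y = y := by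
  ext j
  have h1 := (abs_coord_le_norm y j).trans_lt hy
  rw [abs_lt] at h1
  have h2 : round (y j / (2 * L)) = 0 := by
    rw [round_eq_zero_iff]
    constructor
    · rw [le_div_iff₀ (by positivity)]; linarith
    · rw [div_lt_iff₀ (by positivity)]; linarith
  simp [h2]

/-- A function supported in a ball of radius `R < L` has a periodization which is locally a
translate of the function itself. -/
theorem comp_wrap_eventuallyEq {d : ℕ} {L R : ℝ} (hR : 0 < R) (hRL : R < L) {F : Type*} [Zero F]
    {g : E d → F} (hg : ∀ y, R < ‖y‖ → g y = 0) (y₀ : E d) :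
    (fun y => g (wrap L y)) =ᶠ[nhds y₀]
      fun y => g (y - latticeVec L fun j => round (y₀ j / (2 * L))) := by
  have hL : 0 < L := hR.trans hRL
  filter_upwards [Metric.ball_mem_nhds y₀ (sub_pos.2 hRL)] with y hy
  by_cases h : ∀ j, round (y j / (2 * L)) = round (y₀ j / (2 * L))
  · rw [wrap_eq_sub_latticeVec, funext h]
  · push Not at h
    obtain ⟨j, hj⟩ := h
    -- both representatives leave the ball, because the `j`-th coordinate crosses the boundary
    have hyj : |y j - y₀ j| < L - R := by
      rw [Metric.mem_ball, dist_eq_norm] at hy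
      exact (abs_coord_le_norm (y - y₀) j).trans_lt hy
    set a := round (y j / (2 * L)) with ha
    set b := round (y₀ j / (2 * L)) with hb
    have key : ∀ z : ℝ, |z - 2 * L * round (z / (2 * L))| ≤ L := by
      intro z
      have h1 := abs_sub_round (z / (2 * L))
      have h2 : z - 2 * L * round (z / (2 * L)) = 2 * L * (z / (2 * L) - round (z / (2 * L))) := by
        field_simp
      rw [h2, abs_mul, abs_of_pos (by positivity : 0 < 2 * L)]
      nlinarith
    have h1 := key (y j)
    have h2 := key (y₀ j)
    rw [← ha] at h1
    rw [← hb] at h2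
    have h3 : (1 : ℝ) ≤ |(a : ℝ) - b| := by
      exact_mod_cast Int.one_le_abs (sub_ne_zero.2 hj)
    have hA : R < |y j - 2 * L * a| := by
      rw [abs_le] at h1 h2
      rw [abs_lt] at hyj
      rcases le_abs'.1 h3 with h3 | h3
      · have : 2 * L * ((a : ℝ) - b) ≤ 2 * L * (-1) := by gcongr
        exact lt_abs.2 (Or.inl (by linarith))
      · have : 2 * L * 1 ≤ 2 * L * ((a : ℝ) - b) := by gcongr
        exact lt_abs.2 (Or.inr (by linarith))
    have hB : R < |y j - 2 * L * b| := by
      rw [abs_le] at h1 h2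
      rw [abs_lt] at hyj
      rcases le_abs'.1 h3 with h3 | h3
      · have : 2 * L * ((a : ℝ) - b) ≤ 2 * L * (-1) := by gcongr
        exact lt_abs.2 (Or.inr (by linarith))
      · have : 2 * L * 1 ≤ 2 * L * ((a : ℝ) - b) := by gcongr
        exact lt_abs.2 (Or.inl (by linarith))
    rw [hg, hg]
    · exact hB.trans_le (abs_coord_le_norm (y - latticeVec L fun j => round (y₀ j / (2 * L))) j)
    · exact hA.trans_le (abs_coord_le_norm (wrap L y) j)

theorem contDiff_comp_wrap {d : ℕ} {L R : ℝ} (hR : 0 < R) (hRL : R < L) {F : Type*}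
    [NormedAddCommGroup F] [NormedSpace ℝ F] {n : WithTop ℕ∞} {g : E d → F}
    (hg : ∀ y, R < ‖y‖ → g y = 0) (hn : ContDiff ℝ n g) :
    ContDiff ℝ n fun y => g (wrap L y) := by
  rw [contDiff_iff_contDiffAt]
  intro y₀
  refine ContDiffAt.congr_of_eventuallyEq ?_ (comp_wrap_eventuallyEq hR hRL hg y₀)
  exact (hn.comp (contDiff_id.sub contDiff_const)).contDiffAt

theorem hasFDerivAt_comp_wrap {d : ℕ} {L R : ℝ} (hR : 0 < R) (hRL : R < L) {F : Type*}
    [NormedAddCommGroup F] [NormedSpace ℝ F] {g : E d → F}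
    (hg : ∀ y, R < ‖y‖ → g y = 0) (hn : Differentiable ℝ g) (y₀ : E d) :
    HasFDerivAt (fun y => g (wrap L y)) (fderiv ℝ g (wrap L y₀)) y₀ := by
  refine HasFDerivAt.congr_of_eventuallyEq ?_ (comp_wrap_eventuallyEq hR hRL hg y₀)
  rw [wrap_eq_sub_latticeVec]
  exact (hn _).hasFDerivAt.comp y₀ ((hasFDerivAt_id y₀).sub_const _)

theorem continuous_comp_wrap {d : ℕ} {L R : ℝ} (hR : 0 < R) (hRL : R < L) {F : Type*}
    [Zero F] [TopologicalSpace F] {g : E d → F}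
    (hg : ∀ y, R < ‖y‖ → g y = 0) (hn : Continuous g) :
    Continuous fun y => g (wrap L y) := by
  rw [continuous_iff_continuousAt]
  intro y₀
  refine ContinuousAt.congr ?_ (comp_wrap_eventuallyEq hR hRL hg y₀).symm
  exact (hn.comp (continuous_id.sub continuous_const)).continuousAt

theorem measurable_wrap {d : ℕ} (L : ℝ) : Measurable (wrap L : E d → E d) := by
  have h : Measurable fun y : E d => (fun j => y j - 2 * L * round (y j / (2 * L)) : Fin d → ℝ) := by
    refine measurable_pi_lambda _ fun j => ?_
    have hj : Measurable fun y : E d => y j :=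
      (measurable_pi_apply j).comp (WithLp.measurable_ofLp 2 _)
    have hr : Measurable fun z : ℝ => ((round z : ℤ) : ℝ) := by
      simp_rw [round_eq]
      exact (measurable_from_top (f := fun z : ℤ => (z : ℝ))).comp
        (Int.measurable_floor.comp (measurable_id.add_const _))
    exact hj.sub ((hr.comp (hj.div_const _)).const_mul _)
  exact (WithLp.measurable_toLp 2 _).comp h

/-! ### Liouville's theorem for second order equations -/

section Liouville

open Filter Topology

variable {P : Type*} [NormedAddCommGroup P] [NormedSpace ℝ P]

/-- One step of the splitting scheme for `x' = v`, `v' = F x`: a drift with constant velocity during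
a time `h`, followed by a kick. -/
def driftKick (F : P → P) (h : ℝ) (c : P × P) : P × P :=
  (c.1 + h • c.2, c.2 + h • F (c.1 + h • c.2))

/-- Both the drift and the kick are shears, hence preserve the volume. -/
theorem measurePreserving_driftKick [FiniteDimensional ℝ P] [MeasurableSpace P] [BorelSpace P]
    (μ : Measure P) [μ.IsAddHaarMeasure] {F : P → P} (hF : Continuous F) (h : ℝ) :
    MeasurePreserving (driftKick F h) (μ.prod μ) (μ.prod μ) := by
  have kick : MeasurePreserving (fun c : P × P => (c.1, c.2 + h • F c.1))
      (μ.prod μ) (μ.prod μ) :=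
    (MeasurePreserving.id μ).skew_product (g := fun x v => v + h • F x)
      (by fun_prop) (Eventually.of_forall fun x => map_add_right_eq_self μ _)
  have drift' : MeasurePreserving (fun c : P × P => (c.1, c.2 + h • c.1))
      (μ.prod μ) (μ.prod μ) :=
    (MeasurePreserving.id μ).skew_product (g := fun x v => v + h • x)
      (by fun_prop) (Eventually.of_forall fun x => map_add_right_eq_self μ _)
  have drift : MeasurePreserving (fun c : P × P => (c.1 + h • c.2, c.2))
      (μ.prod μ) (μ.prod μ) :=
    (Measure.measurePreserving_swap.comp drift').comp Measure.measurePreserving_swap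
  exact kick.comp drift

theorem continuous_driftKick {F : P → P} (hF : Continuous F) (h : ℝ) :
    Continuous (driftKick F h) := by
  unfold driftKick; fun_prop

theorem norm_driftKick_sub_le {F : P → P} {Λ : ℝ≥0} (hF : LipschitzWith Λ F) (h : ℝ)
    (a b : P × P) :
    ‖driftKick F h a - driftKick F h b‖ ≤ (1 + |h|) * (1 + |h| * Λ) * ‖a - b‖ := by
  have h1 : ‖a.1 - b.1‖ ≤ ‖a - b‖ := norm_fst_le (a - b)
  have h2 : ‖a.2 - b.2‖ ≤ ‖a - b‖ := norm_snd_le (a - b)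
  have hx : ‖(a.1 + h • a.2) - (b.1 + h • b.2)‖ ≤ (1 + |h|) * ‖a - b‖ := by
    calc ‖(a.1 + h • a.2) - (b.1 + h • b.2)‖ = ‖(a.1 - b.1) + h • (a.2 - b.2)‖ := by
          congr 1; rw [smul_sub]; abel
      _ ≤ ‖a.1 - b.1‖ + |h| * ‖a.2 - b.2‖ := by
          refine (norm_add_le _ _).trans ?_
          rw [norm_smul, Real.norm_eq_abs]
      _ ≤ ‖a - b‖ + |h| * ‖a - b‖ := by gcongr
      _ = _ := by ring
  have hv : ‖(a.2 + h • F (a.1 + h • a.2)) - (b.2 + h • F (b.1 + h • b.2))‖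
      ≤ ‖a - b‖ + |h| * (Λ * ((1 + |h|) * ‖a - b‖)) := by
    calc _ = ‖(a.2 - b.2) + h • (F (a.1 + h • a.2) - F (b.1 + h • b.2))‖ := by
          congr 1; rw [smul_sub]; abel
      _ ≤ ‖a.2 - b.2‖ + |h| * ‖F (a.1 + h • a.2) - F (b.1 + h • b.2)‖ := by
          refine (norm_add_le _ _).trans ?_
          rw [norm_smul, Real.norm_eq_abs]
      _ ≤ _ := by
          gcongr
          exact (hF.norm_sub_le _ _).trans (by gcongr)
  have hn := norm_nonneg (a - b)
  refine max_le (hx.trans ?_) (hv.trans ?_)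
  · have : 0 ≤ (1 + |h|) * (|h| * Λ) * ‖a - b‖ := by positivity
    nlinarith
  · have : 0 ≤ |h| * ‖a - b‖ := by positivity
    nlinarith

/-- `γ` solves the system `x' = v`, `v' = F x`. -/
def IsSecondOrderSolution (F : P → P) (γ : ℝ → P × P) : Prop :=
  ∀ t, HasDerivAt γ ((γ t).2, F (γ t).1) t

namespace IsSecondOrderSolution

variable {F : P → P} {γ : ℝ → P × P} {B : ℝ}

theorem hasDerivAt_fst (hγ : IsSecondOrderSolution F γ) (t : ℝ) :
    HasDerivAt (fun s => (γ s).1) (γ t).2 t := (hγ t).fst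

theorem hasDerivAt_snd (hγ : IsSecondOrderSolution F γ) (t : ℝ) :
    HasDerivAt (fun s => (γ s).2) (F (γ t).1) t := (hγ t).snd

theorem comp_add_const (hγ : IsSecondOrderSolution F γ) (s : ℝ) :
    IsSecondOrderSolution F fun t => γ (t + s) :=
  fun t => (hγ (t + s)).comp_add_const t s

theorem norm_velocity_sub_le (hγ : IsSecondOrderSolution F γ) (hB : ∀ x, ‖F x‖ ≤ B) (t : ℝ) :
    ‖(γ t).2 - (γ 0).2‖ ≤ B * |t| := by
  have := Convex.norm_image_sub_le_of_norm_hasDerivWithin_le (s := Set.univ)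
    (fun s _ => (hγ.hasDerivAt_snd s).hasDerivWithinAt) (fun s _ => hB (γ s).1) convex_univ
    (Set.mem_univ 0) (Set.mem_univ t)
  simpa using this

theorem norm_position_sub_le (hγ : IsSecondOrderSolution F γ) (hB : ∀ x, ‖F x‖ ≤ B) (t : ℝ) :
    ‖(γ t).1 - ((γ 0).1 + t • (γ 0).2)‖ ≤ B * |t| * |t| := by
  have hB0 : 0 ≤ B := (norm_nonneg _).trans (hB 0)
  have hd : ∀ s, HasDerivAt (fun s => (γ s).1 - s • (γ 0).2) ((γ s).2 - (γ 0).2) s := fun s => by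
    simpa using (hγ.hasDerivAt_fst s).fun_sub ((hasDerivAt_id s).smul_const (γ 0).2)
  have := Convex.norm_image_sub_le_of_norm_hasDerivWithin_le (s := Set.uIcc 0 t) (C := B * |t|)
    (fun s _ => (hd s).hasDerivWithinAt) (fun s hs => (hγ.norm_velocity_sub_le hB s).trans ?_)
    (convex_uIcc 0 t) Set.left_mem_uIcc Set.right_mem_uIcc
  · simp only [zero_smul, sub_zero, Real.norm_eq_abs] at this
    rwa [sub_right_comm, sub_sub] at this
  · have := Set.abs_sub_left_of_mem_uIcc hs
    simp only [sub_zero] at this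
    gcongr

/-- The error of a single step of the scheme is of second order. -/
theorem norm_sub_driftKick_le (hγ : IsSecondOrderSolution F γ) (hB : ∀ x, ‖F x‖ ≤ B) {Λ : ℝ≥0}
    (hF : LipschitzWith Λ F) {h : ℝ} (hh : |h| ≤ 1) :
    ‖γ h - driftKick F h (γ 0)‖ ≤ h ^ 2 * (B + Λ * (B + ‖(γ 0).2‖)) := by
  have hB0 : 0 ≤ B := (norm_nonneg _).trans (hB 0)
  have hh2 : |h| * |h| = h ^ 2 := by rw [← sq, sq_abs]
  refine max_le ((hγ.norm_position_sub_le hB h).trans ?_) ?_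
  · have : 0 ≤ h ^ 2 * (Λ * (B + ‖(γ 0).2‖)) := by positivity
    nlinarith
  · set y := (γ 0).1 + h • (γ 0).2 with hy
    have hd : ∀ s, HasDerivAt (fun s => (γ s).2 - s • F y) (F (γ s).1 - F y) s := fun s => by
      simpa using (hγ.hasDerivAt_snd s).fun_sub ((hasDerivAt_id s).smul_const (F y))
    have key := Convex.norm_image_sub_le_of_norm_hasDerivWithin_le (s := Set.uIcc 0 h)
      (C := Λ * ((B + ‖(γ 0).2‖) * |h|))
      (fun s _ => (hd s).hasDerivWithinAt) (fun s hs => (hF.norm_sub_le _ _).trans ?_)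
      (convex_uIcc 0 h) Set.left_mem_uIcc Set.right_mem_uIcc
    · simp only [zero_smul, sub_zero, Real.norm_eq_abs] at key
      rw [sub_right_comm, sub_sub] at key
      calc _ ≤ _ := key
        _ = h ^ 2 * (Λ * (B + ‖(γ 0).2‖)) := by rw [← hh2]; ring
        _ ≤ _ := by gcongr; linarith
    · gcongr
      have hs0 := Set.abs_sub_left_of_mem_uIcc hs
      simp only [sub_zero] at hs0
      have hs1 := Set.abs_sub_right_of_mem_uIcc hs
      simp only [sub_zero] at hs1
      have e : (γ s).1 - y = ((γ s).1 - ((γ 0).1 + s • (γ 0).2)) - (h - s) • (γ 0).2 := by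
        rw [hy, sub_smul]; abel
      calc ‖(γ s).1 - y‖ ≤ B * |s| * |s| + |h - s| * ‖(γ 0).2‖ := by
            rw [e]
            refine (norm_sub_le _ _).trans ?_
            rw [norm_smul, Real.norm_eq_abs]
            gcongr
            exact hγ.norm_position_sub_le hB s
        _ ≤ B * 1 * |h| + |h| * ‖(γ 0).2‖ := by
            gcongr
            exact hs0.trans hh
        _ = _ := by ring

theorem norm_sub_iterate_driftKick_le (hγ : IsSecondOrderSolution F γ) (hB : ∀ x, ‖F x‖ ≤ B)
    {Λ : ℝ≥0} (hF : LipschitzWith Λ F) {h T : ℝ} (hh : |h| ≤ 1) (n : ℕ) (hn : n * |h| ≤ T) :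
    ‖γ (n * h) - (driftKick F h)^[n] (γ 0)‖
      ≤ n * (h ^ 2 * (B + Λ * (B + (‖(γ 0).2‖ + B * T)))) * ((1 + |h|) * (1 + |h| * Λ)) ^ n := by
  have hB0 : 0 ≤ B := (norm_nonneg _).trans (hB 0)
  have hq : 1 ≤ (1 + |h|) * (1 + |h| * (Λ : ℝ)) :=
    one_le_mul_of_one_le_of_one_le (by linarith [abs_nonneg h])
      (by linarith [show 0 ≤ |h| * (Λ : ℝ) by positivity])
  induction n with
  | zero => simp
  | succ n ih =>
    have hnh : n * |h| ≤ T := by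
      refine le_trans ?_ hn
      push_cast
      nlinarith [abs_nonneg h]
    have hT : 0 ≤ T := le_trans (by positivity) hnh
    set q := (1 + |h|) * (1 + |h| * (Λ : ℝ)) with hq'
    set D := h ^ 2 * (B + Λ * (B + (‖(γ 0).2‖ + B * T))) with hD
    have hD0 : 0 ≤ D := by positivity
    have h1 := (hγ.comp_add_const (n * h)).norm_sub_driftKick_le hB hF hh
    simp only [zero_add] at h1
    have hv : ‖(γ (n * h)).2‖ ≤ ‖(γ 0).2‖ + B * T := by
      have h2 := hγ.norm_velocity_sub_le hB (n * h)
      have h3 := norm_le_norm_add_norm_sub' (γ (n * h)).2 (γ 0).2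
      rw [abs_mul, Nat.abs_cast] at h2
      have h4 : B * (n * |h|) ≤ B * T := by gcongr
      linarith
    have h1' : ‖γ (h + n * h) - driftKick F h (γ (n * h))‖ ≤ D := by
      refine h1.trans ?_
      rw [hD]
      gcongr
    have e : ((n + 1 : ℕ) : ℝ) * h = h + n * h := by push_cast; ring
    rw [e, Function.iterate_succ_apply']
    calc _ ≤ ‖γ (h + n * h) - driftKick F h (γ (n * h))‖
          + ‖driftKick F h (γ (n * h)) - driftKick F h ((driftKick F h)^[n] (γ 0))‖ :=
          norm_sub_le_norm_sub_add_norm_sub _ _ _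
      _ ≤ D + q * (n * D * q ^ n) := by
          gcongr
          exact (norm_driftKick_sub_le hF h _ _).trans (by gcongr; exact ih hnh)
      _ ≤ D * q ^ (n + 1) + q * (n * D * q ^ n) := by
          gcongr
          exact le_mul_of_one_le_right hD0 (one_le_pow₀ hq)
      _ = _ := by push_cast; ring

/-- The splitting scheme converges to the solution. -/
theorem tendsto_iterate_driftKick (hγ : IsSecondOrderSolution F γ) (hB : ∀ x, ‖F x‖ ≤ B)
    {Λ : ℝ≥0} (hF : LipschitzWith Λ F) (t : ℝ) :
    Tendsto (fun n : ℕ => (driftKick F (t / n))^[n] (γ 0)) atTop (𝓝 (γ t)) := by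
  have hB0 : 0 ≤ B := (norm_nonneg _).trans (hB 0)
  rw [tendsto_iff_norm_sub_tendsto_zero]
  set D := B + Λ * (B + (‖(γ 0).2‖ + B * |t|)) with hD
  have hlim : Tendsto (fun n : ℕ => t ^ 2 * D * Real.exp (|t| * (1 + Λ)) / (n : ℝ)) atTop (𝓝 0) :=
    tendsto_const_div_atTop_nhds_zero_nat _
  refine squeeze_zero' (Eventually.of_forall fun n => norm_nonneg _) ?_ hlim
  filter_upwards [eventually_ge_atTop (max 1 ⌈|t|⌉₊)] with n hn
  have hn1 : 1 ≤ n := (le_max_left _ _).trans hn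
  have hn0 : (0 : ℝ) < n := by exact_mod_cast hn1
  have hnt : |t| ≤ n := (Nat.le_ceil _).trans (by exact_mod_cast (le_max_right _ _).trans hn)
  have habs : |t / n| = |t| / n := by rw [abs_div, Nat.abs_cast]
  have key := hγ.norm_sub_iterate_driftKick_le hB hF (h := t / n) (T := |t|)
    (by rw [habs]; exact (div_le_one hn0).2 hnt) n
    (by rw [habs]; exact (mul_div_cancel₀ _ hn0.ne').le)
  rw [mul_div_cancel₀ _ hn0.ne', ← hD] at key
  rw [norm_sub_rev]
  refine key.trans ?_
  have hq : ((1 + |t / n|) * (1 + |t / n| * (Λ : ℝ))) ^ n ≤ Real.exp (|t| * (1 + Λ)) := by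
    calc _ ≤ (Real.exp |t / n| * Real.exp (|t / n| * Λ)) ^ n := by
          gcongr
          · rw [add_comm]; exact Real.add_one_le_exp _
          · rw [add_comm]; exact Real.add_one_le_exp _
      _ = _ := by
          rw [← Real.exp_add, ← Real.exp_nat_mul, habs]
          congr 1
          field_simp
  have hD0 : 0 ≤ D := by positivity
  calc _ ≤ n * ((t / n) ^ 2 * D) * Real.exp (|t| * (1 + Λ)) := by gcongr
    _ = _ := by field_simp

end IsSecondOrderSolution

/-- A pointwise limit of measure preserving maps does not increase the measure of preimages. -/
theorem measure_preimage_le_of_tendsto {X : Type*} [TopologicalSpace X] [MeasurableSpace X]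
    [OpensMeasurableSpace X] {ν : Measure X} [ν.OuterRegular] {S : ℕ → X → X} {φ : X → X}
    (hS : ∀ n, MeasurePreserving (S n) ν ν) (hφ : ∀ x, Tendsto (fun n => S n x) atTop (𝓝 (φ x)))
    (A : Set X) : ν (φ ⁻¹' A) ≤ ν A := by
  have hopen : ∀ U : Set X, IsOpen U → ν (φ ⁻¹' U) ≤ ν U := by
    intro U hU
    have hsub : φ ⁻¹' U ⊆ ⋃ n, ⋂ m, ⋂ (_ : n ≤ m), S m ⁻¹' U := by
      intro x hx
      obtain ⟨n, hn⟩ := eventually_atTop.1 ((hφ x).eventually_mem (hU.mem_nhds hx))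
      simp only [Set.mem_iUnion, Set.mem_iInter]
      exact ⟨n, fun m hm => hn m hm⟩
    refine (measure_mono hsub).trans ?_
    rw [Monotone.measure_iUnion]
    · refine iSup_le fun n => ?_
      refine (measure_mono (Set.iInter₂_subset n le_rfl)).trans_eq ?_
      exact (hS n).measure_preimage hU.measurableSet.nullMeasurableSet
    · intro a b hab
      exact Set.iInter_mono fun m => Set.iInter_mono' fun h => ⟨hab.trans h, subset_rfl⟩
  rw [A.measure_eq_iInf_isOpen ν]
  exact le_iInf₂ fun U hAU => le_iInf fun hU =>
    (measure_mono (Set.preimage_mono hAU)).trans (hopen U hU)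

/-- **Liouville's theorem**: the flow of `x' = v`, `v' = F x` preserves the volume. -/
theorem measurePreserving_secondOrderFlow [FiniteDimensional ℝ P] [MeasurableSpace P]
    [BorelSpace P] (μ : Measure P) [μ.IsAddHaarMeasure] {F : P → P} {Λ : ℝ≥0}
    (hF : LipschitzWith Λ F) {B : ℝ} (hB : ∀ x, ‖F x‖ ≤ B) {φ : ℝ → P × P → P × P}
    (h0 : ∀ c, φ 0 c = c) (hadd : ∀ s t c, φ s (φ t c) = φ (s + t) c)
    (hφ : ∀ c, IsSecondOrderSolution F fun t => φ t c) (t : ℝ) :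
    MeasurePreserving (φ t) (μ.prod μ) (μ.prod μ) := by
  have hlim : ∀ t c, Tendsto (fun n : ℕ => (driftKick F (t / n))^[n] c) atTop (𝓝 (φ t c)) := by
    intro t c
    simpa only [h0] using (hφ c).tendsto_iterate_driftKick hB hF t
  have hmeas : ∀ t, Measurable (φ t) := fun t =>
    measurable_of_tendsto_metrizable
      (fun n => ((continuous_driftKick hF.continuous _).iterate n).measurable)
      (tendsto_pi_nhds.2 fun c => hlim t c)
  have hle : ∀ t A, (μ.prod μ) (φ t ⁻¹' A) ≤ (μ.prod μ) A := fun t A =>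
    measure_preimage_le_of_tendsto
      (fun n => (measurePreserving_driftKick μ hF.continuous _).iterate n) (hlim t) A
  refine ⟨hmeas t, Measure.ext fun A hA => ?_⟩
  rw [Measure.map_apply (hmeas t) hA]
  refine le_antisymm (hle t A) ?_
  have : A = φ (-t) ⁻¹' (φ t ⁻¹' A) := by
    ext c
    simp [hadd, h0]
  conv_lhs => rw [this]
  exact hle (-t) _

end Liouville

/-! ### The interaction force -/

section Force

variable {d : ℕ} {R : ℝ} {Φ : E d → ℝ}

theorem gradient_eq_zero_of_lt (hsupp : Function.support Φ ⊆ Metric.closedBall 0 R) {y : E d}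
    (hy : R < ‖y‖) : gradient Φ y = 0 := by
  have h : Φ =ᶠ[nhds y] fun _ => 0 := by
    have ho : {z : E d | R < ‖z‖} ∈ nhds y :=
      (isOpen_lt continuous_const continuous_norm).mem_nhds hy
    filter_upwards [ho] with z hz
    by_contra hne
    have := hsupp hne
    rw [mem_closedBall_zero_iff] at this
    exact absurd this (not_le.2 hz)
  rw [gradient, h.fderiv_eq]
  simp

theorem potential_eq_zero_of_lt (hsupp : Function.support Φ ⊆ Metric.closedBall 0 R) {y : E d}
    (hy : R < ‖y‖) : Φ y = 0 := by
  by_contra hne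
  have := hsupp hne
  rw [mem_closedBall_zero_iff] at this
  exact absurd this (not_le.2 hy)

theorem hasCompactSupport_of_eq_zero {F : Type*} [Zero F] {g : E d → F}
    (hg : ∀ y, R < ‖y‖ → g y = 0) : HasCompactSupport g :=
  HasCompactSupport.intro (isCompact_closedBall (0 : E d) R) fun y hy => hg y (by
    simpa using hy)

theorem contDiff_gradient (hΦ : ContDiff ℝ 3 Φ) : ContDiff ℝ 2 (gradient Φ) := by
  have h : ContDiff ℝ 2 (fderiv ℝ Φ) := hΦ.fderiv_right (by norm_num)
  exact (InnerProductSpace.toDual ℝ (E d)).symm.toContinuousLinearEquiv.contDiff.comp h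

theorem exists_norm_gradient_le (hΦ : ContDiff ℝ 3 Φ)
    (hsupp : Function.support Φ ⊆ Metric.closedBall 0 R) :
    ∃ B, 0 ≤ B ∧ ∀ y, ‖gradient Φ y‖ ≤ B := by
  obtain ⟨B, hB⟩ := (contDiff_gradient hΦ).continuous.bounded_above_of_compact_support
    (hasCompactSupport_of_eq_zero fun y hy => gradient_eq_zero_of_lt hsupp hy)
  exact ⟨B, (norm_nonneg _).trans (hB 0), hB⟩

theorem exists_abs_potential_le (hΦ : ContDiff ℝ 3 Φ)
    (hsupp : Function.support Φ ⊆ Metric.closedBall 0 R) :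
    ∃ B, 0 ≤ B ∧ ∀ y, |Φ y| ≤ B := by
  obtain ⟨B, hB⟩ := hΦ.continuous.bounded_above_of_compact_support
    (hasCompactSupport_of_eq_zero fun y hy => potential_eq_zero_of_lt hsupp hy)
  exact ⟨B, (norm_nonneg _).trans (hB 0), hB⟩

theorem exists_lipschitzWith_gradient_wrap (hR : 0 < R) (hΦ : ContDiff ℝ 3 Φ)
    (hsupp : Function.support Φ ⊆ Metric.closedBall 0 R) {L : ℝ} (hRL : R < L) :
    ∃ Λ : ℝ≥0, LipschitzWith Λ fun y => gradient Φ (wrap L y) := by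
  have hg : ∀ y, R < ‖y‖ → gradient Φ y = 0 := fun y hy => gradient_eq_zero_of_lt hsupp hy
  have h1 : ContDiff ℝ 1 (fderiv ℝ (gradient Φ)) :=
    (contDiff_gradient hΦ).fderiv_right (by norm_num)
  obtain ⟨Λ, hΛ⟩ := h1.continuous.bounded_above_of_compact_support
    ((hasCompactSupport_of_eq_zero hg).fderiv ℝ)
  have hd := hasFDerivAt_comp_wrap hR hRL hg ((contDiff_gradient hΦ).differentiable (by norm_num))
  refine ⟨Λ.toNNReal, lipschitzWith_of_nnnorm_fderiv_le (fun y => (hd y).differentiableAt) ?_⟩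
  intro y
  rw [(hd y).fderiv, ← NNReal.coe_le_coe, coe_nnnorm]
  exact (hΛ _).trans (Real.le_coe_toNNReal Λ)

end Force

/-! ### Positions and velocities -/

/-- Positions (or velocities) of the tagged particle and of `M` background particles. -/
abbrev Positions (d M : ℕ) : Type := E d × (Fin M → E d)

theorem isAddHaarMeasure_volume_prod {G H : Type*} [NormedAddCommGroup G] [NormedAddCommGroup H]
    [MeasureSpace G] [MeasureSpace H] [BorelSpace G] [BorelSpace H] [SecondCountableTopology G]
    [SecondCountableTopology H] [(volume : Measure G).IsAddHaarMeasure]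
    [(volume : Measure H).IsAddHaarMeasure] [SFinite (volume : Measure G)]
    [SFinite (volume : Measure H)] : (volume : Measure (G × H)).IsAddHaarMeasure :=
  Measure.prod.instIsAddHaarMeasure _ _

theorem isAddHaarMeasure_volume_pi {ι G : Type*} [Fintype ι] [NormedAddCommGroup G]
    [MeasureSpace G] [BorelSpace G] [SecondCountableTopology G]
    [(volume : Measure G).IsAddHaarMeasure] [SigmaFinite (volume : Measure G)] :
    (volume : Measure (ι → G)).IsAddHaarMeasure :=
  Measure.pi.isAddHaarMeasure _

instance instIsAddHaarMeasurePhase (d : ℕ) : (volume : Measure (Phase d)).IsAddHaarMeasure :=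
  isAddHaarMeasure_volume_prod

instance instSigmaFinitePhases (d M : ℕ) : SigmaFinite (volume : Measure (Fin M → Phase d)) :=
  Measure.pi.sigmaFinite _

instance instIsAddHaarMeasurePhases (d M : ℕ) :
    (volume : Measure (Fin M → Phase d)).IsAddHaarMeasure :=
  isAddHaarMeasure_volume_pi

instance instIsAddHaarMeasureConfig (d M : ℕ) :
    (volume : Measure (Config d M)).IsAddHaarMeasure :=
  isAddHaarMeasure_volume_prod

instance instIsAddHaarMeasurePositions (d M : ℕ) :
    (volume : Measure (Positions d M)).IsAddHaarMeasure :=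
  isAddHaarMeasure_volume_prod

/-- A configuration as a pair (positions, velocities). -/
noncomputable def splitEquiv (d M : ℕ) : Config d M ≃L[ℝ] Positions d M × Positions d M :=
  LinearEquiv.toContinuousLinearEquiv
    { toFun := fun c => ((c.1.1, fun i => (c.2 i).1), (c.1.2, fun i => (c.2 i).2))
      invFun := fun p => ((p.1.1, p.2.1), fun i => (p.1.2 i, p.2.2 i))
      map_add' := fun _ _ => rfl
      map_smul' := fun _ _ => rfl
      left_inv := fun _ => rfl
      right_inv := fun _ => rfl }

@[simp] theorem splitEquiv_apply {d M : ℕ} (c : Config d M) :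
    splitEquiv d M c = ((c.1.1, fun i => (c.2 i).1), (c.1.2, fun i => (c.2 i).2)) := rfl

@[simp] theorem splitEquiv_symm_apply {d M : ℕ} (p : Positions d M × Positions d M) :
    (splitEquiv d M).symm p = ((p.1.1, p.2.1), fun i => (p.1.2 i, p.2.2 i)) := rfl

/-- The accelerations as a linear function of the interaction forces. -/
noncomputable def accelerationMap (d M N : ℕ) : (Fin M → E d) →L[ℝ] Positions d M :=
  (-((N : ℝ)⁻¹ • ∑ i, ContinuousLinearMap.proj i)).prod
    ((N : ℝ)⁻¹ • ContinuousLinearMap.id ℝ _)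

/-- The accelerations of all particles as a function of the positions. -/
noncomputable def acceleration {d M : ℕ} (N : ℕ) (η : ℝ) (Φ : E d → ℝ) (p : Positions d M) :
    Positions d M :=
  accelerationMap d M N fun i => gradient Φ (wrap (halfSide N η) (p.1 - p.2 i))

theorem newtonField_eq {d M : ℕ} (N : ℕ) (η : ℝ) (Φ : E d → ℝ) (c : Config d M) :
    newtonField N η Φ c =
      (splitEquiv d M).symm ((splitEquiv d M c).2, acceleration N η Φ (splitEquiv d M c).1) := by
  simp only [newtonField, acceleration, accelerationMap, relPos, splitEquiv_apply,
    splitEquiv_symm_apply, ContinuousLinearMap.prod_apply, neg_apply,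
    smul_apply, sum_apply, ContinuousLinearMap.proj_apply,
    ContinuousLinearMap.id_apply, Pi.smul_apply]

section Field

variable {d M N : ℕ} {η R : ℝ} {Φ : E d → ℝ}

theorem contDiff_acceleration (hR : 0 < R) (hΦ : ContDiff ℝ 3 Φ)
    (hsupp : Function.support Φ ⊆ Metric.closedBall 0 R) (hRL : R < halfSide N η) :
    ContDiff ℝ 1 (acceleration N η Φ : Positions d M → Positions d M) := by
  have hG : ContDiff ℝ 2 fun y => gradient Φ (wrap (halfSide N η) y) :=
    contDiff_comp_wrap hR hRL (fun y hy => gradient_eq_zero_of_lt hsupp hy) (contDiff_gradient hΦ)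
  refine (accelerationMap d M N).contDiff.comp (contDiff_pi.2 fun i => ?_)
  refine (hG.of_le (by norm_num)).comp (contDiff_fst.sub ?_)
  exact (contDiff_apply ℝ (E d) i).comp contDiff_snd

theorem exists_lipschitzWith_acceleration (hR : 0 < R) (hΦ : ContDiff ℝ 3 Φ)
    (hsupp : Function.support Φ ⊆ Metric.closedBall 0 R) (hRL : R < halfSide N η) :
    ∃ Λ, LipschitzWith Λ (acceleration N η Φ : Positions d M → Positions d M) := by
  obtain ⟨Λ, hΛ⟩ := exists_lipschitzWith_gradient_wrap hR hΦ hsupp hRL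
  have h : LipschitzWith (Λ * 2) fun (p : Positions d M) (i : Fin M) =>
      gradient Φ (wrap (halfSide N η) (p.1 - p.2 i)) := by
    refine LipschitzWith.of_dist_le_mul fun p q => (dist_pi_le_iff (by positivity)).2 fun i => ?_
    refine (hΛ.dist_le_mul _ _).trans ?_
    push_cast
    rw [mul_assoc]
    refine mul_le_mul_of_nonneg_left ?_ Λ.2
    have h1 : dist p.1 q.1 ≤ dist p q := le_max_left _ _
    have h2 : dist (p.2 i) (q.2 i) ≤ dist p q := (dist_le_pi_dist _ _ i).trans (le_max_right _ _)
    linarith [dist_sub_sub_le p.1 (p.2 i) q.1 (q.2 i)]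
  exact ⟨_, (accelerationMap d M N).lipschitz.comp h⟩

theorem exists_norm_acceleration_le (hΦ : ContDiff ℝ 3 Φ)
    (hsupp : Function.support Φ ⊆ Metric.closedBall 0 R) :
    ∃ B, ∀ p : Positions d M, ‖acceleration N η Φ p‖ ≤ B := by
  obtain ⟨B, hB0, hB⟩ := exists_norm_gradient_le hΦ hsupp
  refine ⟨‖accelerationMap d M N‖ * B, fun p => ((accelerationMap d M N).le_opNorm _).trans ?_⟩
  gcongr
  exact (pi_norm_le_iff_of_nonneg hB0).2 fun i => hB _

theorem contDiff_newtonField (hR : 0 < R) (hΦ : ContDiff ℝ 3 Φ)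
    (hsupp : Function.support Φ ⊆ Metric.closedBall 0 R) (hRL : R < halfSide N η) :
    ContDiff ℝ 1 (newtonField N η Φ : Config d M → Config d M) := by
  have he := (splitEquiv d M).contDiff (n := 1)
  have h := (splitEquiv d M).symm.contDiff.comp ((contDiff_snd.comp he).prodMk
    ((contDiff_acceleration hR hΦ hsupp hRL).comp (contDiff_fst.comp he)))
  rwa [show newtonField N η Φ = _ from funext (newtonField_eq N η Φ)]

theorem exists_lipschitzWith_newtonField (hR : 0 < R) (hΦ : ContDiff ℝ 3 Φ)
    (hsupp : Function.support Φ ⊆ Metric.closedBall 0 R) (hRL : R < halfSide N η) :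
    ∃ Λ, LipschitzWith Λ (newtonField N η Φ : Config d M → Config d M) := by
  obtain ⟨Λ, hΛ⟩ := exists_lipschitzWith_acceleration (M := M) hR hΦ hsupp hRL
  have he := (splitEquiv d M).lipschitz
  have h := (splitEquiv d M).symm.lipschitz.comp ((LipschitzWith.prod_snd.comp he).prodMk
    (hΛ.comp (LipschitzWith.prod_fst.comp he)))
  rw [show newtonField N η Φ = _ from funext (newtonField_eq N η Φ)]
  exact ⟨_, h⟩

/-! ### The flow -/

theorem isTrajectory_flow (hR : 0 < R) (hΦ : ContDiff ℝ 3 Φ)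
    (hsupp : Function.support Φ ⊆ Metric.closedBall 0 R) (hRL : R < halfSide N η)
    (c : Config d M) : IsTrajectory N η Φ c (flow N η Φ c) := by
  obtain ⟨Λ, hΛ⟩ := exists_lipschitzWith_newtonField (M := M) hR hΦ hsupp hRL
  have h : ∃ γ, IsTrajectory N η Φ c γ :=
    exists_global_solution (contDiff_newtonField hR hΦ hsupp hRL) hΛ c
  rw [flow, dif_pos h]
  exact h.choose_spec

theorem eq_flow_of_isTrajectory (hR : 0 < R) (hΦ : ContDiff ℝ 3 Φ)
    (hsupp : Function.support Φ ⊆ Metric.closedBall 0 R) (hRL : R < halfSide N η)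
    {c : Config d M} {γ : ℝ → Config d M} (hγ : IsTrajectory N η Φ c γ) :
    γ = flow N η Φ c := by
  obtain ⟨Λ, hΛ⟩ := exists_lipschitzWith_newtonField (M := M) hR hΦ hsupp hRL
  have hf := isTrajectory_flow hR hΦ hsupp hRL c
  exact ODE_solution_unique_univ (v := fun _ => newtonField N η Φ) (s := fun _ => Set.univ)
    (t₀ := 0) (fun _ => hΛ.lipschitzOnWith) (fun t => ⟨hγ.2 t, trivial⟩)
    (fun t => ⟨hf.2 t, trivial⟩) (hγ.1.trans hf.1.symm)

theorem flow_zero (hR : 0 < R) (hΦ : ContDiff ℝ 3 Φ)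
    (hsupp : Function.support Φ ⊆ Metric.closedBall 0 R) (hRL : R < halfSide N η)
    (c : Config d M) : flow N η Φ c 0 = c :=
  (isTrajectory_flow hR hΦ hsupp hRL c).1

theorem flow_flow (hR : 0 < R) (hΦ : ContDiff ℝ 3 Φ)
    (hsupp : Function.support Φ ⊆ Metric.closedBall 0 R) (hRL : R < halfSide N η)
    (c : Config d M) (s t : ℝ) : flow N η Φ (flow N η Φ c t) s = flow N η Φ c (s + t) := by
  have hc := isTrajectory_flow hR hΦ hsupp hRL c
  have h : IsTrajectory N η Φ (flow N η Φ c t) fun s => flow N η Φ c (s + t) :=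
    ⟨by simp, fun s => (hc.2 (s + t)).comp_add_const s t⟩
  exact (congrFun (eq_flow_of_isTrajectory hR hΦ hsupp hRL h) s).symm

/-- **Liouville's theorem** for the flow of the tagged particle and its background. -/
theorem measurePreserving_flow (hR : 0 < R) (hΦ : ContDiff ℝ 3 Φ)
    (hsupp : Function.support Φ ⊆ Metric.closedBall 0 R) (hRL : R < halfSide N η) (t : ℝ) :
    MeasurePreserving (fun c : Config d M => flow N η Φ c t) volume volume := by
  obtain ⟨Λ, hΛ⟩ := exists_lipschitzWith_acceleration (M := M) hR hΦ hsupp hRL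
  obtain ⟨B, hB⟩ := exists_norm_acceleration_le (M := M) (N := N) (η := η) hΦ hsupp
  let e := splitEquiv d M
  let μ : Measure (Positions d M × Positions d M) :=
    (volume : Measure (Positions d M)).prod (volume : Measure (Positions d M))
  have hμ : μ.IsAddHaarMeasure := isAddHaarMeasure_volume_prod
  have hsol : ∀ p, IsSecondOrderSolution (acceleration N η Φ)
      fun t => e (flow N η Φ (e.symm p) t) := by
    intro p t
    have h := e.hasFDerivAt.comp_hasDerivAt t
      ((isTrajectory_flow hR hΦ hsupp hRL (e.symm p)).2 t)
    refine h.congr_deriv ?_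
    rw [newtonField_eq]
    exact e.apply_symm_apply _
  have hmp : MeasurePreserving (fun p => e (flow N η Φ (e.symm p) t)) μ μ :=
    measurePreserving_secondOrderFlow (volume : Measure (Positions d M)) hΛ hB
      (φ := fun t p => e (flow N η Φ (e.symm p) t))
      (fun p => by simp [flow_zero hR hΦ hsupp hRL])
      (fun s t p => by simp only [e.symm_apply_apply, flow_flow hR hΦ hsupp hRL])
      hsol t
  -- `volume` on configurations is a multiple of the product of the volumes on positions and
  -- velocities, since both are Haar measures
  have hes : Measurable e.symm := e.symm.continuous.measurable
  have he : Measurable e := e.continuous.measurable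
  have : (μ.map e.symm).IsAddHaarMeasure := e.symm.isAddHaarMeasure_map μ
  have hmap : MeasurePreserving (fun c : Config d M => flow N η Φ c t)
      (μ.map e.symm) (μ.map e.symm) := by
    have h1 : MeasurePreserving e.symm μ (μ.map e.symm) := ⟨hes, rfl⟩
    have h2 : MeasurePreserving e (μ.map e.symm) μ :=
      ⟨he, by rw [Measure.map_map he hes]; simp⟩
    have h3 := (h1.comp hmp).comp h2
    convert h3 using 1
    ext1 c
    simp [Function.comp]
  rw [Measure.isAddLeftInvariant_eq_smul (volume : Measure (Config d M)) (μ.map e.symm)]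
  exact ⟨hmap.measurable, by rw [Measure.map_smul, hmap.map_eq]⟩

end Field

/-! ### Periodicity -/

section Periodic

variable {d M N : ℕ} {η R : ℝ} {Φ : E d → ℝ}

/-- Translation of the positions of all particles by vectors of the period lattice `(2 L ℤ)^d`. -/
noncomputable def latticeHom (d M : ℕ) (L : ℝ) :
    (Fin d → ℤ) × (Fin M → Fin d → ℤ) →+ Config d M where
  toFun m := ((latticeVec L m.1, 0), fun i => (latticeVec L (m.2 i), 0))
  map_zero' := by
    have : latticeVec L (0 : Fin d → ℤ) = 0 := by ext j; simp
    ext <;> simp [this]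
  map_add' m m' := by
    have h : ∀ a b : Fin d → ℤ, latticeVec L (a + b) = latticeVec L a + latticeVec L b := by
      intro a b; ext j; simp; ring
    ext <;> simp [h]

theorem latticeHom_apply (L : ℝ) (m : (Fin d → ℤ) × (Fin M → Fin d → ℤ)) :
    latticeHom d M L m = ((latticeVec L m.1, 0), fun i => (latticeVec L (m.2 i), 0)) := rfl

/-- Configurations all of whose particles are in the fundamental domain of the torus. -/
def cubeConfig (d M : ℕ) (L : ℝ) : Set (Config d M) :=
  {c | c.1.1 ∈ cube d L ∧ ∀ i, (c.2 i).1 ∈ cube d L}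

theorem measurableSet_cube (d : ℕ) (L : ℝ) : MeasurableSet (cube d L) := by
  have : cube d L = ⋂ j, (fun x : E d => x j) ⁻¹' Set.Ico (-L) L := by
    ext x; simp [cube]
  rw [this]
  refine MeasurableSet.iInter fun j => ?_
  exact ((measurable_pi_apply j).comp (WithLp.measurable_ofLp 2 _)) measurableSet_Ico

theorem measurableSet_cubeConfig (d M : ℕ) (L : ℝ) : MeasurableSet (cubeConfig d M L) := by
  have : cubeConfig d M L = (fun c : Config d M => c.1.1) ⁻¹' cube d L ∩
      ⋂ i, (fun c : Config d M => (c.2 i).1) ⁻¹' cube d L := by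
    ext x; simp [cubeConfig]
  rw [this]
  refine (measurable_fst.comp measurable_fst (measurableSet_cube d L)).inter
    (MeasurableSet.iInter fun i => ?_)
  exact measurable_fst.comp ((measurable_pi_apply i).comp measurable_snd) (measurableSet_cube d L)

theorem existsUnique_latticeVec_add_mem_cube {L : ℝ} (hL : 0 < L) (x : E d) :
    ∃! m : Fin d → ℤ, latticeVec L m + x ∈ cube d L := by
  have h : ∀ j, ∃! n : ℤ, 2 * L * n + x j ∈ Set.Ico (-L) L := by
    intro j
    have := existsUnique_add_zsmul_mem_Ico (by positivity : 0 < 2 * L) (x j) (-L)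
    have h1 : ∀ n : ℤ, x j + n • (2 * L) = 2 * L * n + x j := fun n => by
      rw [zsmul_eq_mul]; ring
    simpa only [h1, show -L + 2 * L = L by ring] using this
  choose m hm hu using h
  exact ⟨m, fun j => hm j, fun m' hm' => funext fun j => hu j _ (hm' j)⟩

theorem existsUnique_latticeHom_add_mem_cubeConfig {L : ℝ} (hL : 0 < L) (c : Config d M) :
    ∃! g : (latticeHom d M L).range, g +ᵥ c ∈ cubeConfig d M L := by
  obtain ⟨a, ha, hau⟩ := existsUnique_latticeVec_add_mem_cube hL c.1.1
  choose b hb hbu using fun i => existsUnique_latticeVec_add_mem_cube hL (c.2 i).1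
  refine ⟨⟨latticeHom d M L (a, b), ⟨_, rfl⟩⟩, ⟨ha, hb⟩, ?_⟩
  rintro ⟨_, ⟨m, rfl⟩⟩ hm
  have h1 : m.1 = a := hau _ hm.1
  have h2 : m.2 = b := funext fun i => hbu i _ (hm.2 i)
  subst h1 h2
  rfl

theorem relPos_latticeHom_add {L : ℝ} (hL : 0 < L) (m : (Fin d → ℤ) × (Fin M → Fin d → ℤ))
    (c : Config d M) (i : Fin M) : relPos L (latticeHom d M L m + c) i = relPos L c i := by
  have : (latticeHom d M L m + c).1.1 - ((latticeHom d M L m + c).2 i).1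
      = (c.1.1 - (c.2 i).1) + latticeVec L (m.1 - m.2 i) := by
    ext j
    simp only [latticeHom_apply, Prod.fst_add, Prod.snd_add, Pi.add_apply, PiLp.sub_apply,
      PiLp.add_apply, latticeVec_apply, Pi.sub_apply]
    push_cast; ring
  rw [relPos, this, wrap_add_latticeVec hL, relPos]

theorem newtonField_latticeHom_add (hL : 0 < halfSide N η)
    (m : (Fin d → ℤ) × (Fin M → Fin d → ℤ)) (c : Config d M) :
    newtonField N η Φ (latticeHom d M (halfSide N η) m + c) = newtonField N η Φ c := by
  simp only [newtonField, relPos_latticeHom_add hL]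
  simp [latticeHom_apply]

theorem flow_latticeHom_add (hR : 0 < R) (hΦ : ContDiff ℝ 3 Φ)
    (hsupp : Function.support Φ ⊆ Metric.closedBall 0 R) (hRL : R < halfSide N η)
    (m : (Fin d → ℤ) × (Fin M → Fin d → ℤ)) (c : Config d M) (t : ℝ) :
    flow N η Φ (latticeHom d M (halfSide N η) m + c) t =
      latticeHom d M (halfSide N η) m + flow N η Φ c t := by
  have hc := isTrajectory_flow hR hΦ hsupp hRL c
  have h : IsTrajectory N η Φ (latticeHom d M (halfSide N η) m + c)
      fun t => latticeHom d M (halfSide N η) m + flow N η Φ c t :=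
    ⟨by simp only [hc.1], fun t => by
      rw [newtonField_latticeHom_add (hR.trans hRL)]
      exact (hc.2 t).const_add _⟩
  exact (congrFun (eq_flow_of_isTrajectory hR hΦ hsupp hRL h) t).symm

theorem measurable_flow (hR : 0 < R) (hΦ : ContDiff ℝ 3 Φ)
    (hsupp : Function.support Φ ⊆ Metric.closedBall 0 R) (hRL : R < halfSide N η) (t : ℝ) :
    Measurable fun c : Config d M => flow N η Φ c t :=
  (measurePreserving_flow hR hΦ hsupp hRL t).measurable

/-- The flow preserves the Lebesgue measure of the torus: it commutes with the translations by the
period lattice, so that it maps fundamental domains to fundamental domains. -/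
theorem setLIntegral_cubeConfig_comp_flow (hR : 0 < R) (hΦ : ContDiff ℝ 3 Φ)
    (hsupp : Function.support Φ ⊆ Metric.closedBall 0 R) (hRL : R < halfSide N η) (t : ℝ)
    {f : Config d M → ℝ≥0∞} (hf : Measurable f)
    (hper : ∀ m c, f (latticeHom d M (halfSide N η) m + c) = f c) :
    ∫⁻ c in cubeConfig d M (halfSide N η), f (flow N η Φ c t) =
      ∫⁻ c in cubeConfig d M (halfSide N η), f c := by
  set L := halfSide N η with hL
  have hL0 : 0 < L := hR.trans hRL
  have hD : IsAddFundamentalDomain (latticeHom d M L).range (cubeConfig d M L) volume :=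
    IsAddFundamentalDomain.mk' (measurableSet_cubeConfig d M L).nullMeasurableSet
      (existsUnique_latticeHom_add_mem_cubeConfig hL0)
  set D' : Set (Config d M) := (fun c => flow N η Φ c (-t)) ⁻¹' cubeConfig d M L with hD'
  have hD'm : MeasurableSet D' :=
    measurable_flow hR hΦ hsupp hRL (-t) (measurableSet_cubeConfig d M L)
  have hfund : IsAddFundamentalDomain (latticeHom d M L).range D' volume := by
    refine IsAddFundamentalDomain.mk' hD'm.nullMeasurableSet fun c => ?_
    have h := existsUnique_latticeHom_add_mem_cubeConfig hL0 (flow N η Φ c (-t))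
    convert h using 2 with g
    obtain ⟨_, ⟨m, rfl⟩⟩ := g
    change flow N η Φ (latticeHom d M L m + c) (-t) ∈ cubeConfig d M L ↔
      latticeHom d M L m + flow N η Φ c (-t) ∈ cubeConfig d M L
    rw [flow_latticeHom_add hR hΦ hsupp hRL]
  have hpre : (fun c : Config d M => flow N η Φ c t) ⁻¹' D' = cubeConfig d M L := by
    ext c
    simp only [hD', Set.mem_preimage, flow_flow hR hΦ hsupp hRL, neg_add_cancel,
      flow_zero hR hΦ hsupp hRL]
  have hcount : Countable (latticeHom d M L).range := by
    have : Countable (Set.range (latticeHom d M L)) := (Set.countable_range _).to_subtype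
    exact this
  calc ∫⁻ c in cubeConfig d M L, f (flow N η Φ c t)
      = ∫⁻ c in D', f c := by
        rw [← hpre]
        exact (measurePreserving_flow hR hΦ hsupp hRL t).setLIntegral_comp_preimage hD'm hf
    _ = ∫⁻ c in cubeConfig d M L, f c := by
        refine hfund.setLIntegral_eq hD f ?_
        rintro ⟨_, ⟨m, rfl⟩⟩ c
        exact hper m c

/-! ### Invariance of the Gibbs measure -/

/-- The total energy of a configuration. -/
noncomputable def energy (N : ℕ) (η : ℝ) (Φ : E d → ℝ) (c : Config d M) : ℝ :=
  ‖c.1.2‖ ^ 2 / 2 + ∑ i, ‖(c.2 i).2‖ ^ 2 / 2 + (N : ℝ)⁻¹ * ∑ i, Φ (relPos (halfSide N η) c i)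

theorem gibbsDensity_eq (c : Config d M) :
    gibbsDensity N η Φ c = ((2 * Real.pi) ^ (-(d : ℝ) / 2)) ^ (M + 1) *
      Real.exp (-energy N η Φ c) := by
  simp only [gibbsDensity, gaussianDensity, energy]
  rw [Finset.prod_mul_distrib, Finset.prod_const, Finset.card_univ, Fintype.card_fin,
    ← Real.exp_sum]
  rw [show -(‖c.1.2‖ ^ 2 / 2 + ∑ i, ‖(c.2 i).2‖ ^ 2 / 2 +
      (N : ℝ)⁻¹ * ∑ i, Φ (relPos (halfSide N η) c i)) =
      -((N : ℝ)⁻¹ * ∑ i, Φ (relPos (halfSide N η) c i)) + -‖c.1.2‖ ^ 2 / 2 +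
        ∑ i, -‖(c.2 i).2‖ ^ 2 / 2 by
    simp only [neg_div, Finset.sum_neg_distrib]; ring, Real.exp_add, Real.exp_add]
  ring

theorem energy_flow (hR : 0 < R) (hΦ : ContDiff ℝ 3 Φ)
    (hsupp : Function.support Φ ⊆ Metric.closedBall 0 R) (hRL : R < halfSide N η)
    (c : Config d M) (t : ℝ) : energy N η Φ (flow N η Φ c t) = energy N η Φ c := by
  have hc := isTrajectory_flow hR hΦ hsupp hRL c
  set γ := flow N η Φ c with hγ
  have hd : ∀ t, HasDerivAt (fun t => energy N η Φ (γ t)) 0 t := by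
    intro t
    have h := hc.2 t
    set G : Fin M → E d := fun i => gradient Φ (relPos (halfSide N η) (γ t) i) with hG
    have hX : HasDerivAt (fun t => (γ t).1.1) (γ t).1.2 t := h.fst.fst
    have hV : HasDerivAt (fun t => (γ t).1.2) (-((N : ℝ)⁻¹ • ∑ i, G i)) t := h.fst.snd
    have hx : ∀ i, HasDerivAt (fun t => ((γ t).2 i).1) ((γ t).2 i).2 t :=
      fun i => (hasDerivAt_pi.1 h.snd i).fst
    have hv : ∀ i, HasDerivAt (fun t => ((γ t).2 i).2) ((N : ℝ)⁻¹ • G i) t :=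
      fun i => (hasDerivAt_pi.1 h.snd i).snd
    have hΦi : ∀ i, HasDerivAt (fun t => Φ (relPos (halfSide N η) (γ t) i))
        (inner ℝ (G i) ((γ t).1.2 - ((γ t).2 i).2)) t := by
      intro i
      have h1 := hasFDerivAt_comp_wrap hR hRL (fun y hy => potential_eq_zero_of_lt hsupp hy)
        (hΦ.differentiable (by norm_num)) ((γ t).1.1 - ((γ t).2 i).1)
      refine (h1.comp_hasDerivAt t (hX.sub (hx i))).congr_deriv ?_
      rw [hG]
      simp only [gradient, InnerProductSpace.toDual_symm_apply, relPos]
    have hsum := ((hV.norm_sq.div_const 2).add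
      (HasDerivAt.fun_sum fun i (_ : i ∈ Finset.univ) => (hv i).norm_sq.div_const 2)).add
      ((HasDerivAt.fun_sum fun i (_ : i ∈ Finset.univ) => hΦi i).const_mul (N : ℝ)⁻¹)
    refine hsum.congr_deriv ?_
    simp only [inner_neg_right, real_inner_smul_right, inner_sum, inner_sub_left,
      Finset.sum_sub_distrib, mul_div_assoc, ← Finset.mul_sum, ← Finset.sum_div,
      real_inner_comm _ (G _)]
    ring
  have := is_const_of_deriv_eq_zero (fun t => (hd t).differentiableAt) (fun t => (hd t).deriv) t 0
  rw [this, hc.1]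

theorem gibbsDensity_flow (hR : 0 < R) (hΦ : ContDiff ℝ 3 Φ)
    (hsupp : Function.support Φ ⊆ Metric.closedBall 0 R) (hRL : R < halfSide N η)
    (c : Config d M) (t : ℝ) : gibbsDensity N η Φ (flow N η Φ c t) = gibbsDensity N η Φ c := by
  rw [gibbsDensity_eq, gibbsDensity_eq, energy_flow hR hΦ hsupp hRL]

theorem measurable_relPos (L : ℝ) (i : Fin M) : Measurable fun c : Config d M => relPos L c i := by
  unfold relPos
  exact (measurable_wrap L).comp (by fun_prop)

theorem measurable_gaussianDensity : Measurable (gaussianDensity : E d → ℝ) := by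
  unfold gaussianDensity; fun_prop

theorem measurable_gibbsDensity (hΦ : ContDiff ℝ 3 Φ) :
    Measurable (gibbsDensity N η Φ : Config d M → ℝ) := by
  have h1 : ∀ i, Measurable fun c : Config d M => Φ (relPos (halfSide N η) c i) := fun i =>
    hΦ.continuous.measurable.comp (measurable_relPos _ i)
  have h2 : ∀ i, Measurable fun c : Config d M => gaussianDensity (c.2 i).2 := fun i =>
    measurable_gaussianDensity.comp (by fun_prop)
  have h3 : Measurable fun c : Config d M => gaussianDensity c.1.2 :=
    measurable_gaussianDensity.comp (by fun_prop)
  exact ((((Finset.measurable_fun_sum _ fun i _ => h1 i).const_mul _).neg.exp).mul h3).mul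
    (Finset.measurable_fun_prod _ fun i _ => h2 i)

theorem gibbsDensity_latticeHom_add (hL : 0 < halfSide N η)
    (m : (Fin d → ℤ) × (Fin M → Fin d → ℤ)) (c : Config d M) :
    gibbsDensity N η Φ (latticeHom d M (halfSide N η) m + c) = gibbsDensity N η Φ c := by
  simp only [gibbsDensity, relPos_latticeHom_add hL]
  simp [latticeHom_apply]

theorem phaseVolume_eq (d : ℕ) (L : ℝ) :
    phaseVolume d L = (volume : Measure (Phase d)).restrict (cube d L ×ˢ Set.univ) := by
  rw [phaseVolume, Measure.volume_eq_prod, ← Measure.prod_restrict, Measure.restrict_univ]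

instance instSigmaFinitePhaseVolume (d : ℕ) (L : ℝ) : SigmaFinite (phaseVolume d L) := by
  rw [phaseVolume_eq]; infer_instance

theorem phaseVolume_prod_pi_eq (d M : ℕ) (L : ℝ) :
    (phaseVolume d L).prod (Measure.pi fun _ : Fin M => phaseVolume d L) =
      (volume : Measure (Config d M)).restrict (cubeConfig d M L) := by
  have h : cubeConfig d M L = (cube d L ×ˢ Set.univ) ×ˢ
      (Set.univ.pi fun _ : Fin M => cube d L ×ˢ Set.univ) := by
    ext c; simp [cubeConfig]
  rw [h, Measure.volume_eq_prod, ← Measure.prod_restrict, ← phaseVolume_eq, volume_pi,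
    Measure.restrict_pi_pi]
  simp only [phaseVolume_eq]

/-- The Gibbs measure is invariant under the flow. -/
theorem gibbsMeasure_preimage_flow (hR : 0 < R) (hΦ : ContDiff ℝ 3 Φ)
    (hsupp : Function.support Φ ⊆ Metric.closedBall 0 R) (hRL : R < halfSide N η) (t : ℝ)
    {A : Set (Config d M)} (hA : MeasurableSet A)
    (hper : ∀ m c, latticeHom d M (halfSide N η) m + c ∈ A ↔ c ∈ A) :
    gibbsMeasure N η Φ M ((fun c => flow N η Φ c t) ⁻¹' A) = gibbsMeasure N η Φ M A := by
  have hmeas := measurable_flow (M := M) hR hΦ hsupp hRL t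
  have hρ : Measurable fun c : Config d M => ENNReal.ofReal (gibbsDensity N η Φ c) :=
    (measurable_gibbsDensity hΦ).ennreal_ofReal
  rw [gibbsMeasure, withDensity_apply _ (hmeas hA), withDensity_apply _ hA,
    ← lintegral_indicator (hmeas hA), ← lintegral_indicator hA, phaseVolume_prod_pi_eq]
  rw [← setLIntegral_cubeConfig_comp_flow hR hΦ hsupp hRL t (hρ.indicator hA)]
  · refine lintegral_congr fun c => ?_
    by_cases h : flow N η Φ c t ∈ A <;>
      simp [h, gibbsDensity_flow hR hΦ hsupp hRL]
  · intro m c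
    by_cases h : c ∈ A <;>
      simp [Set.indicator, hper, h, gibbsDensity_latticeHom_add (hR.trans hRL)]

end Periodic

/-! ### The grand canonical measure -/

section Mecke

variable {d M N : ℕ} {η R : ℝ} {Φ : E d → ℝ}

/-- The factor of the Gibbs density due to one additional background particle. -/
noncomputable def insertionDensity (N : ℕ) (η : ℝ) (Φ : E d → ℝ) (Z z : Phase d) : ℝ :=
  gaussianDensity z.2 * Real.exp (-((N : ℝ)⁻¹ * Φ (wrap (halfSide N η) (Z.1 - z.1))))

theorem gaussianDensity_nonneg (v : E d) : 0 ≤ gaussianDensity v := by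
  unfold gaussianDensity; positivity

theorem gibbsDensity_cons (Z z₀ : Phase d) (z : Fin M → Phase d) :
    gibbsDensity N η Φ ((Z, Fin.cons z₀ z) : Config d (M + 1)) =
      gibbsDensity N η Φ ((Z, z) : Config d M) * insertionDensity N η Φ Z z₀ := by
  simp only [gibbsDensity, insertionDensity, relPos, Fin.sum_univ_succ, Fin.prod_univ_succ,
    Fin.cons_zero, Fin.cons_succ]
  rw [mul_add, neg_add, Real.exp_add]
  ring

theorem gibbsDensity_nonneg (c : Config d M) : 0 ≤ gibbsDensity N η Φ c := by
  exact mul_nonneg (mul_nonneg (Real.exp_nonneg _) (gaussianDensity_nonneg _))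
    (Finset.prod_nonneg fun i _ => gaussianDensity_nonneg _)

theorem lintegral_pi_succ (μ : Measure (Phase d)) [SigmaFinite μ]
    {f : (Fin (M + 1) → Phase d) → ℝ≥0∞} (hf : Measurable f) :
    ∫⁻ z, f z ∂(Measure.pi fun _ => μ) =
      ∫⁻ z, ∫⁻ z₀, f (Fin.cons z₀ z) ∂μ ∂(Measure.pi fun _ : Fin M => μ) := by
  have h := (measurePreserving_piFinSuccAbove (fun _ : Fin (M + 1) => μ) 0).symm
  rw [← h.lintegral_comp hf, lintegral_prod_symm']
  · refine lintegral_congr fun z => lintegral_congr fun z₀ => ?_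
    exact congrArg f (Fin.insertNth_zero' z₀ z)
  · exact hf.comp (MeasurableEquiv.measurable _)

theorem measurable_cons_config (Z : Phase d) (z : Fin M → Phase d) :
    Measurable fun z₀ : Phase d => ((Z, Fin.cons z₀ z) : Config d (M + 1)) := by
  refine measurable_const.prodMk (measurable_pi_lambda _ fun i => ?_)
  refine Fin.cases ?_ (fun i => ?_) i
  · exact measurable_id
  · exact measurable_const

/-- Integrating out one background particle. -/
theorem gibbsMeasure_succ_le (hΦ : ContDiff ℝ 3 Φ) {B : Set (Config d (M + 1))}
    (hB : MeasurableSet B) {κ : ℝ≥0∞}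
    (hκ : ∀ Z z, ∫⁻ z₀ in {z₀ | ((Z, Fin.cons z₀ z) : Config d (M + 1)) ∈ B},
      ENNReal.ofReal (insertionDensity N η Φ Z z₀) ∂(phaseVolume d (halfSide N η)) ≤ κ) :
    gibbsMeasure N η Φ (M + 1) B ≤ κ * gibbsMeasure N η Φ M Set.univ := by
  set μ := phaseVolume d (halfSide N η) with hμ
  have hρ : ∀ M, Measurable fun c : Config d M => ENNReal.ofReal (gibbsDensity N η Φ c) :=
    fun M => (measurable_gibbsDensity hΦ).ennreal_ofReal
  have hBρ : Measurable (B.indicator fun c : Config d (M + 1) =>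
    ENNReal.ofReal (gibbsDensity N η Φ c)) := (hρ _).indicator hB
  rw [gibbsMeasure, withDensity_apply _ hB, ← lintegral_indicator hB,
    gibbsMeasure, withDensity_apply _ MeasurableSet.univ, Measure.restrict_univ,
    lintegral_prod _ hBρ.aemeasurable, lintegral_prod _ (hρ _).aemeasurable,
    ← lintegral_const_mul _ (hρ _).lintegral_prod_right']
  refine lintegral_mono fun Z => ?_
  refine (lintegral_pi_succ μ (hBρ.comp measurable_prodMk_left)).trans_le ?_
  refine le_of_le_of_eq ?_ (lintegral_const_mul κ ((hρ M).comp measurable_prodMk_left))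
  refine lintegral_mono fun z => ?_
  have hcons := measurable_cons_config Z z
  calc ∫⁻ z₀, B.indicator (fun c : Config d (M + 1) => ENNReal.ofReal (gibbsDensity N η Φ c))
          (Z, Fin.cons z₀ z) ∂μ
      = ∫⁻ z₀, ENNReal.ofReal (gibbsDensity N η Φ ((Z, z) : Config d M)) *
          {z₀ | ((Z, Fin.cons z₀ z) : Config d (M + 1)) ∈ B}.indicator
            (fun z₀ => ENNReal.ofReal (insertionDensity N η Φ Z z₀)) z₀ ∂μ := by
        refine lintegral_congr fun z₀ => ?_
        by_cases h : ((Z, Fin.cons z₀ z) : Config d (M + 1)) ∈ B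
        · simp [h, gibbsDensity_cons, ENNReal.ofReal_mul (gibbsDensity_nonneg _)]
        · simp [h]
    _ = ENNReal.ofReal (gibbsDensity N η Φ ((Z, z) : Config d M)) *
          ∫⁻ z₀ in {z₀ | ((Z, Fin.cons z₀ z) : Config d (M + 1)) ∈ B},
            ENNReal.ofReal (insertionDensity N η Φ Z z₀) ∂μ := by
        rw [lintegral_const_mul' _ _ ENNReal.ofReal_ne_top]
        congr 1
        exact lintegral_indicator (hcons hB) _
    _ ≤ ENNReal.ofReal (gibbsDensity N η Φ ((Z, z) : Config d M)) * κ := by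
        gcongr; exact hκ Z z
    _ = _ := mul_comm _ _

theorem measurable_sigmaMk (M : ℕ) :
    Measurable fun c : Config d M => (⟨M, c⟩ : GrandConfig d) := by
  refine fun s hs => ?_
  exact (MeasurableSpace.measurableSet_iInf.1 hs) M

theorem measurableSet_grandConfig {B : ∀ M, Set (Config d M)} (hB : ∀ M, MeasurableSet (B M)) :
    MeasurableSet {ω : GrandConfig d | ω.2 ∈ B ω.1} :=
  MeasurableSpace.measurableSet_iInf.2 fun M => hB M

theorem measurable_sigma_fst {X : Type*} [MeasurableSpace X] (f : ℕ → X) :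
    Measurable fun ω : GrandConfig d => f ω.1 := by
  intro s hs
  refine MeasurableSpace.measurableSet_iInf.2 fun M => ?_
  exact (measurable_const (a := f M) : Measurable fun _ : Config d M => f M) hs

theorem hatMeasure_apply {B : ∀ M, Set (Config d M)} (hB : ∀ M, MeasurableSet (B M)) :
    hatMeasure N η Φ {ω | ω.2 ∈ B ω.1} =
      (unnormalizedMeasure N η Φ Set.univ)⁻¹ *
        ∑' M : ℕ, ((N : ℝ≥0∞) ^ M / (M.factorial : ℝ≥0∞)) *
          ((M : ℝ≥0∞) / N * gibbsMeasure N η Φ M (B M)) := by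
  have hS := measurableSet_grandConfig hB
  rw [hatMeasure, withDensity_apply _ hS, grandCanonical, Measure.restrict_smul,
    lintegral_smul_measure, smul_eq_mul, ← lintegral_indicator hS, unnormalizedMeasure,
    lintegral_sum_measure]
  congr 1
  refine tsum_congr fun M => ?_
  rw [lintegral_smul_measure, smul_eq_mul, lintegral_map _ (measurable_sigmaMk M)]
  · congr 1
    calc _ = ∫⁻ c, (B M).indicator (fun _ => (M : ℝ≥0∞) / N) c ∂(gibbsMeasure N η Φ M) := rfl
      _ = _ := by rw [lintegral_indicator_const (hB M)]
  · exact (measurable_sigma_fst fun M => (M : ℝ≥0∞) / N).indicator hS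

/-- The non-symmetric expectation amounts to adding particle 1 to a grand canonical configuration
(the Mecke formula for the Poisson measure): the probability of an event is at most the largest
conditional measure of the positions and velocities of particle 1, given the other particles. -/
theorem hatMeasure_le (hΦ : ContDiff ℝ 3 Φ) (hN : 0 < N)
    {B : ∀ M, Set (Config d M)} (hB : ∀ M, MeasurableSet (B M)) {κ : ℝ≥0∞}
    (hκ : ∀ M Z z, ∫⁻ z₀ in {z₀ | ((Z, Fin.cons z₀ z) : Config d (M + 1)) ∈ B (M + 1)},
      ENNReal.ofReal (insertionDensity N η Φ Z z₀) ∂(phaseVolume d (halfSide N η)) ≤ κ) :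
    hatMeasure N η Φ {ω | ω.2 ∈ B ω.1} ≤ κ := by
  have hN0 : (N : ℝ≥0∞) ≠ 0 := by exact_mod_cast hN.ne'
  have hNt : (N : ℝ≥0∞) ≠ ⊤ := ENNReal.natCast_ne_top N
  have hU : unnormalizedMeasure N η Φ Set.univ =
      ∑' M : ℕ, ((N : ℝ≥0∞) ^ M / (M.factorial : ℝ≥0∞)) * gibbsMeasure N η Φ M Set.univ := by
    rw [unnormalizedMeasure, Measure.sum_apply _ MeasurableSet.univ]
    refine tsum_congr fun M => ?_
    rw [Measure.smul_apply, smul_eq_mul, Measure.map_apply (measurable_sigmaMk M)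
      MeasurableSet.univ, Set.preimage_univ]
  have hsum : ∑' M : ℕ, ((N : ℝ≥0∞) ^ M / (M.factorial : ℝ≥0∞)) *
      ((M : ℝ≥0∞) / N * gibbsMeasure N η Φ M (B M)) ≤
        κ * unnormalizedMeasure N η Φ Set.univ := by
    rw [tsum_eq_zero_add' ENNReal.summable, hU, ← ENNReal.tsum_mul_left]
    simp only [Nat.cast_zero, ENNReal.zero_div, zero_mul, mul_zero, zero_add]
    refine ENNReal.tsum_le_tsum fun M => ?_
    have hfac : ((M + 1).factorial : ℝ≥0∞) = ((M + 1 : ℕ) : ℝ≥0∞) * (M.factorial : ℝ≥0∞) := by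
      rw [Nat.factorial_succ]; push_cast; ring
    have hcoef : (N : ℝ≥0∞) ^ (M + 1) / ((M + 1).factorial : ℝ≥0∞) * (((M + 1 : ℕ) : ℝ≥0∞) / N)
        = (N : ℝ≥0∞) ^ M / (M.factorial : ℝ≥0∞) := by
      have h1 : ((M + 1 : ℕ) : ℝ≥0∞) ≠ 0 := by exact_mod_cast M.succ_ne_zero
      have h2 : ((M + 1 : ℕ) : ℝ≥0∞) ≠ ⊤ := ENNReal.natCast_ne_top _
      rw [hfac, pow_succ, div_eq_mul_inv, div_eq_mul_inv, div_eq_mul_inv,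
        ENNReal.mul_inv (Or.inl h1) (Or.inl h2)]
      calc _ = (N : ℝ≥0∞) ^ M * (M.factorial : ℝ≥0∞)⁻¹ * ((N : ℝ≥0∞) * (N : ℝ≥0∞)⁻¹) *
            (((M + 1 : ℕ) : ℝ≥0∞) * ((M + 1 : ℕ) : ℝ≥0∞)⁻¹) := by ring
        _ = _ := by
          rw [ENNReal.mul_inv_cancel hN0 hNt, ENNReal.mul_inv_cancel h1 h2, mul_one, mul_one]
    calc _ = (N : ℝ≥0∞) ^ M / (M.factorial : ℝ≥0∞) * gibbsMeasure N η Φ (M + 1) (B (M + 1)) := by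
          rw [← mul_assoc, hcoef]
      _ ≤ (N : ℝ≥0∞) ^ M / (M.factorial : ℝ≥0∞) * (κ * gibbsMeasure N η Φ M Set.univ) := by
          gcongr
          exact gibbsMeasure_succ_le hΦ (hB _) (hκ M)
      _ = _ := by ring
  rw [hatMeasure_apply hB]
  calc _ ≤ (unnormalizedMeasure N η Φ Set.univ)⁻¹ * (κ * unnormalizedMeasure N η Φ Set.univ) := by
        gcongr
    _ = κ * ((unnormalizedMeasure N η Φ Set.univ)⁻¹ * unnormalizedMeasure N η Φ Set.univ) := by
        ring
    _ ≤ κ * 1 := by gcongr; exact ENNReal.inv_mul_le_one _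
    _ = κ := mul_one κ

theorem hatMeasure_preimage_flow (hR : 0 < R) (hΦ : ContDiff ℝ 3 Φ)
    (hsupp : Function.support Φ ⊆ Metric.closedBall 0 R) (hRL : R < halfSide N η) (t : ℝ)
    {B : ∀ M, Set (Config d M)} (hB : ∀ M, MeasurableSet (B M))
    (hper : ∀ M m c, latticeHom d M (halfSide N η) m + c ∈ B M ↔ c ∈ B M) :
    hatMeasure N η Φ {ω | flow N η Φ ω.2 t ∈ B ω.1} = hatMeasure N η Φ {ω | ω.2 ∈ B ω.1} := by
  refine (hatMeasure_apply (B := fun M => (fun c => flow N η Φ c t) ⁻¹' B M)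
    fun M => measurable_flow hR hΦ hsupp hRL t (hB M)).trans ?_
  rw [hatMeasure_apply hB]
  simp only [gibbsMeasure_preimage_flow hR hΦ hsupp hRL t (hB _) (hper _)]

end Mecke

/-! ### Recollisions with a free particle -/

section FreeRecollision

variable {d M N : ℕ} {η R : ℝ} {Φ : E d → ℝ}

/-- The configuration without particle 1. -/
def removeFirst (c : Config d (M + 1)) : Config d M := (c.1, fun i => c.2 i.succ)

/-- Particle 1 is close to the tagged particle and, if it moved freely while the tagged particle
interacts with the other particles only, the two would be within distance `2 R` of each other at some
time `ε j h` with `j h ≥ a`.  The sign `ε = ±1` is the direction of time.  Displacements are used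
instead of positions, since only the former are well defined on the torus. -/
def freeRecollision (N : ℕ) (η R : ℝ) (Φ : E d → ℝ) (ε h a : ℝ) : ∀ M, Set (Config d M)
  | 0 => ∅
  | _ + 1 => {c | ‖relPos (halfSide N η) c 0‖ ≤ 10 * R ∧ ∃ j : ℕ, a ≤ j * h ∧
      ‖(ε * (j * h)) • (c.2 0).2 - relPos (halfSide N η) c 0 -
        ((flow N η Φ (removeFirst c) (ε * (j * h))).1.1 - c.1.1)‖ ≤ 2 * R}

theorem mem_freeRecollision_succ {ε h a : ℝ} {c : Config d (M + 1)} :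
    c ∈ freeRecollision N η R Φ ε h a (M + 1) ↔
      ‖relPos (halfSide N η) c 0‖ ≤ 10 * R ∧ ∃ j : ℕ, a ≤ j * h ∧
      ‖(ε * (j * h)) • (c.2 0).2 - relPos (halfSide N η) c 0 -
        ((flow N η Φ (removeFirst c) (ε * (j * h))).1.1 - c.1.1)‖ ≤ 2 * R := Iff.rfl

theorem mem_freeRecollision_cons {ε h a : ℝ} {Z z₀ : Phase d} {z : Fin M → Phase d} :
    ((Z, Fin.cons z₀ z) : Config d (M + 1)) ∈ freeRecollision N η R Φ ε h a (M + 1) ↔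
      ‖wrap (halfSide N η) (Z.1 - z₀.1)‖ ≤ 10 * R ∧ ∃ j : ℕ, a ≤ j * h ∧
      ‖(ε * (j * h)) • z₀.2 - wrap (halfSide N η) (Z.1 - z₀.1) -
        ((flow N η Φ ((Z, z) : Config d M) (ε * (j * h))).1.1 - Z.1)‖ ≤ 2 * R := by
  have : removeFirst ((Z, Fin.cons z₀ z) : Config d (M + 1)) = (Z, z) := by
    simp [removeFirst]
  rw [mem_freeRecollision_succ, this]
  exact Iff.rfl

theorem measurable_removeFirst : Measurable (removeFirst : Config d (M + 1) → Config d M) := by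
  unfold removeFirst; fun_prop

theorem measurableSet_freeRecollision (hR : 0 < R) (hΦ : ContDiff ℝ 3 Φ)
    (hsupp : Function.support Φ ⊆ Metric.closedBall 0 R) (hRL : R < halfSide N η) (ε h a : ℝ)
    (M : ℕ) : MeasurableSet (freeRecollision N η R Φ ε h a M) := by
  cases M with
  | zero => exact MeasurableSet.empty
  | succ M =>
    have hrel := measurable_relPos (d := d) (M := M + 1) (halfSide N η) 0
    have hflow : ∀ t, Measurable fun c : Config d (M + 1) => flow N η Φ (removeFirst c) t :=
      fun t => (measurable_flow hR hΦ hsupp hRL t).comp measurable_removeFirst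
    have : freeRecollision N η R Φ ε h a (M + 1) =
        {c | ‖relPos (halfSide N η) c 0‖ ≤ 10 * R} ∩ ⋃ j : ℕ, ⋃ _ : a ≤ j * h,
          {c | ‖(ε * (j * h)) • (c.2 0).2 - relPos (halfSide N η) c 0 -
            ((flow N η Φ (removeFirst c) (ε * (j * h))).1.1 - c.1.1)‖ ≤ 2 * R} := by
      ext c; simp [mem_freeRecollision_succ]
    rw [this]
    refine (measurableSet_le hrel.norm measurable_const).inter
      (MeasurableSet.iUnion fun j => MeasurableSet.iUnion fun _ => ?_)
    refine measurableSet_le (Measurable.norm ?_) measurable_const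
    have h1 : Measurable fun c : Config d (M + 1) => (flow N η Φ (removeFirst c) (ε * (j * h))).1.1 :=
      measurable_fst.comp (measurable_fst.comp (hflow _))
    have h2 : Measurable fun c : Config d (M + 1) => (ε * (j * h)) • (c.2 0).2 := by fun_prop
    have h3 : Measurable fun c : Config d (M + 1) => c.1.1 := by fun_prop
    exact (h2.sub hrel).sub (h1.sub h3)

theorem latticeHom_add_mem_freeRecollision (hR : 0 < R) (hΦ : ContDiff ℝ 3 Φ)
    (hsupp : Function.support Φ ⊆ Metric.closedBall 0 R) (hRL : R < halfSide N η) (ε h a : ℝ)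
    (M : ℕ) (m : (Fin d → ℤ) × (Fin M → Fin d → ℤ)) (c : Config d M) :
    latticeHom d M (halfSide N η) m + c ∈ freeRecollision N η R Φ ε h a M ↔
      c ∈ freeRecollision N η R Φ ε h a M := by
  cases M with
  | zero => rfl
  | succ M =>
    have hred : removeFirst (latticeHom d (M + 1) (halfSide N η) m + c) =
        latticeHom d M (halfSide N η) (m.1, fun i => m.2 i.succ) + removeFirst c := rfl
    have hX : ∀ t, (flow N η Φ (removeFirst (latticeHom d (M + 1) (halfSide N η) m + c)) t).1.1 -
        (latticeHom d (M + 1) (halfSide N η) m + c).1.1 =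
          (flow N η Φ (removeFirst c) t).1.1 - c.1.1 := by
      intro t
      rw [hred, flow_latticeHom_add hR hΦ hsupp hRL]
      exact add_sub_add_left_eq_sub _ _ _
    have hv : ((latticeHom d (M + 1) (halfSide N η) m + c).2 0).2 = (c.2 0).2 := by
      simp [latticeHom_apply]
    simp only [mem_freeRecollision_succ, relPos_latticeHom_add (hR.trans hRL), hX, hv]

/-- The ball around `X` on the torus, seen in the fundamental domain, is covered by the `3 ^ d`
balls around the representatives of `X` in the neighbouring cells. -/
theorem volume_cube_inter_le {L : ℝ} (hL : 0 < L) (X : E d) (r : ℝ) :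
    volume ({x : E d | ‖wrap L (X - x)‖ ≤ r} ∩ cube d L) ≤
      3 ^ d * volume (Metric.closedBall (0 : E d) r) := by
  set S : Finset (Fin d → ℤ) := Fintype.piFinset fun j =>
    Finset.Icc (round (X j / (2 * L)) - 1) (round (X j / (2 * L)) + 1) with hS
  have hsub : {x : E d | ‖wrap L (X - x)‖ ≤ r} ∩ cube d L ⊆
      ⋃ m ∈ S, Metric.closedBall (X - latticeVec L m) r := by
    rintro x ⟨hx, hxc⟩
    simp only [Set.mem_iUnion, exists_prop]
    refine ⟨fun j => round ((X - x) j / (2 * L)), ?_, ?_⟩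
    · rw [hS, Fintype.mem_piFinset]
      intro j
      have h1 := abs_sub_round ((X - x) j / (2 * L))
      have h2 := abs_sub_round (X j / (2 * L))
      have h3 := hxc j
      have h4 : (X - x) j / (2 * L) = X j / (2 * L) - x j / (2 * L) := by
        simp [sub_div]
      have h5 : -(1 / 2) ≤ x j / (2 * L) := by
        rw [le_div_iff₀ (by positivity)]; linarith [h3.1]
      have h6 : x j / (2 * L) < 1 / 2 := by
        rw [div_lt_iff₀ (by positivity)]; linarith [h3.2]
      rw [h4] at h1 ⊢
      rw [abs_le] at h1 h2
      rw [Finset.mem_Icc]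
      have h7 : (round (X j / (2 * L) - x j / (2 * L)) : ℝ) < round (X j / (2 * L)) + 2 := by
        linarith
      have h8 : (round (X j / (2 * L)) : ℝ) < round (X j / (2 * L) - x j / (2 * L)) + 2 := by
        linarith
      norm_cast at h7 h8
      omega
    · have hx' : ‖wrap L (X - x)‖ ≤ r := hx
      rw [wrap_eq_sub_latticeVec] at hx'
      rw [mem_closedBall_iff_norm, ← norm_neg]
      rwa [neg_sub, sub_right_comm]
  refine (measure_mono hsub).trans ((measure_biUnion_finset_le _ _).trans ?_)
  have hcard : S.card = 3 ^ d := by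
    rw [hS, Fintype.card_piFinset]
    have : ∀ n : ℤ, (Finset.Icc (n - 1) (n + 1)).card = 3 := fun n => by
      rw [Int.card_Icc]; omega
    simp [this]
  simp only [Measure.addHaar_closedBall_center, Finset.sum_const, hcard, nsmul_eq_mul]
  push_cast
  rfl

theorem sum_range_inv_sq_le {b : ℝ} (hb : 0 < b) (n : ℕ) :
    ∑ j ∈ (Finset.range n).filter (fun j : ℕ => b ≤ j), ((j : ℝ) ^ 2)⁻¹ ≤ 2 / b := by
  have hc : 0 < ⌈b⌉₊ := Nat.ceil_pos.2 hb
  calc _ ≤ ∑ j ∈ Finset.Ioo (⌈b⌉₊ - 1) n, ((j : ℝ) ^ 2)⁻¹ := by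
        refine Finset.sum_le_sum_of_subset_of_nonneg ?_ fun _ _ _ => by positivity
        intro j hj
        rw [Finset.mem_filter, Finset.mem_range] at hj
        have := Nat.ceil_le.2 hj.2
        rw [Finset.mem_Ioo]
        omega
    _ ≤ 2 / ((⌈b⌉₊ - 1 : ℕ) + 1) := sum_Ioo_inv_sq_le _ _
    _ = 2 / (⌈b⌉₊ : ℝ) := by
        rw [← Nat.cast_add_one, Nat.sub_add_cancel hc]
    _ ≤ 2 / b := by
        gcongr; exact Nat.le_ceil b

/-- The summand is, up to a constant, the volume of the velocities for which a free recollision is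
possible at the time `j h`. -/
theorem tsum_inv_pow_le {h a : ℝ} (hh : 0 < h) (ha : 0 < a) (hd : 2 ≤ d) :
    ∑' j : ℕ, (if a ≤ j * h then ENNReal.ofReal (((j * h) ^ d)⁻¹) else 0) ≤
      ENNReal.ofReal (2 * h⁻¹ * (a ^ (d - 1))⁻¹) := by
  refine ENNReal.tsum_le_of_sum_range_le fun n => ?_
  rw [← Finset.sum_filter, ← ENNReal.ofReal_sum_of_nonneg fun j _ => by positivity]
  refine ENNReal.ofReal_le_ofReal ?_
  obtain ⟨k, rfl⟩ : ∃ k, d = k + 2 := ⟨d - 2, by omega⟩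
  have hfil : (Finset.range n).filter (fun j : ℕ => a ≤ j * h) =
      (Finset.range n).filter (fun j : ℕ => a / h ≤ j) := by
    refine Finset.filter_congr fun j _ => ?_
    rw [div_le_iff₀ hh]
  calc _ ≤ ∑ j ∈ (Finset.range n).filter (fun j : ℕ => a ≤ j * h),
        (a ^ k)⁻¹ * (h ^ 2)⁻¹ * ((j : ℝ) ^ 2)⁻¹ := by
        refine Finset.sum_le_sum fun j hj => ?_
        have hj := (Finset.mem_filter.1 hj).2
        rw [← mul_inv, ← mul_inv, pow_add, mul_assoc (a ^ k), mul_comm (h ^ 2), ← mul_pow]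
        have h0 : 0 < j * h := ha.trans_le hj
        gcongr
    _ = (a ^ k)⁻¹ * (h ^ 2)⁻¹ *
        ∑ j ∈ (Finset.range n).filter (fun j : ℕ => a / h ≤ j), ((j : ℝ) ^ 2)⁻¹ := by
        rw [hfil, Finset.mul_sum]
    _ ≤ (a ^ k)⁻¹ * (h ^ 2)⁻¹ * (2 / (a / h)) := by
        gcongr
        exact sum_range_inv_sq_le (by positivity) n
    _ = _ := by
        rw [show k + 2 - 1 = k + 1 by omega]
        field_simp
        exact pow_succ a k

theorem gaussianDensity_le_one (v : E d) : gaussianDensity v ≤ 1 := by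
  unfold gaussianDensity
  refine mul_le_one₀ ?_ (Real.exp_nonneg _) ?_
  · refine Real.rpow_le_one_of_one_le_of_nonpos ?_ ?_
    · linarith [Real.pi_gt_three]
    · have : (0 : ℝ) ≤ d := Nat.cast_nonneg d
      linarith
  · rw [Real.exp_le_one_iff]
    have := sq_nonneg ‖v‖
    linarith

theorem insertionDensity_le {b : ℝ} (hb : ∀ y, |Φ y| ≤ b) (hN : 0 < N) (Z z : Phase d) :
    insertionDensity N η Φ Z z ≤ Real.exp b := by
  unfold insertionDensity
  refine (mul_le_of_le_one_left (Real.exp_nonneg _) (gaussianDensity_le_one _)).trans ?_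
  refine Real.exp_le_exp.2 ((neg_le_abs _).trans ?_)
  have hN1 : (1 : ℝ) ≤ N := by exact_mod_cast hN
  rw [abs_mul, abs_of_nonneg (by positivity : (0 : ℝ) ≤ (N : ℝ)⁻¹)]
  calc (N : ℝ)⁻¹ * |Φ (wrap (halfSide N η) (Z.1 - z.1))| ≤ 1 * b := by
        gcongr
        · exact inv_le_one_of_one_le₀ hN1
        · exact hb _
    _ = b := one_mul b

theorem volume_velocity_le {ε s r : ℝ} (hε : |ε| = 1) (hs : 0 < s) (p : E d) :
    volume {v : E d | ‖(ε * s) • v - p‖ ≤ r} ≤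
      ENNReal.ofReal ((s ^ d)⁻¹) * volume (Metric.closedBall (0 : E d) r) := by
  have hεs : |ε * s| = s := by rw [abs_mul, hε, one_mul, abs_of_pos hs]
  have hne : ε * s ≠ 0 := by
    intro h0; rw [h0, abs_zero] at hεs; exact hs.ne hεs
  have : {v : E d | ‖(ε * s) • v - p‖ ≤ r} =
      (fun v => (ε * s) • v) ⁻¹' Metric.closedBall p r := by
    ext v; simp [dist_eq_norm]
  rw [this, Measure.addHaar_preimage_smul _ hne, Measure.addHaar_closedBall_center]
  simp only [finrank_euclideanSpace, Fintype.card_fin]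
  rw [abs_inv, abs_pow, hεs]

/-- The probability that an additional particle has a free recollision. -/
theorem hatMeasure_freeRecollision_le (hd : 2 ≤ d) (hR : 0 < R) (hΦ : ContDiff ℝ 3 Φ)
    (hsupp : Function.support Φ ⊆ Metric.closedBall 0 R) (hRL : R < halfSide N η)
    (hN : 0 < N) {b : ℝ} (hb : ∀ y, |Φ y| ≤ b) {ε h a : ℝ} (hε : |ε| = 1) (hh : 0 < h)
    (ha : 0 < a) :
    hatMeasure N η Φ {ω : GrandConfig d | ω.2 ∈ freeRecollision N η R Φ ε h a ω.1} ≤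
      ENNReal.ofReal (Real.exp b) * (3 ^ d * volume (Metric.closedBall (0 : E d) (10 * R))) *
        volume (Metric.closedBall (0 : E d) (2 * R)) *
        ENNReal.ofReal (2 * h⁻¹ * (a ^ (d - 1))⁻¹) := by
  set L := halfSide N η with hL
  refine hatMeasure_le hΦ hN (measurableSet_freeRecollision hR hΦ hsupp hRL ε h a)
    fun M Z z => ?_
  set S : Set (Phase d) :=
    {z₀ | ((Z, Fin.cons z₀ z) : Config d (M + 1)) ∈ freeRecollision N η R Φ ε h a (M + 1)} with hS
  have hSm : MeasurableSet S :=
    measurable_cons_config Z z (measurableSet_freeRecollision hR hΦ hsupp hRL ε h a (M + 1))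
  set T : Set (E d) := {x | ‖wrap L (Z.1 - x)‖ ≤ 10 * R} with hT
  have hTm : MeasurableSet T := by
    have : Measurable fun x : E d => wrap L (Z.1 - x) :=
      (measurable_wrap L).comp (measurable_const.sub measurable_id)
    exact measurableSet_le this.norm measurable_const
  set κ : ℝ≥0∞ := volume (Metric.closedBall (0 : E d) (2 * R)) *
    ENNReal.ofReal (2 * h⁻¹ * (a ^ (d - 1))⁻¹) with hκ
  have hslice : ∀ x, volume (Prod.mk x ⁻¹' S) ≤ T.indicator (fun _ => κ) x := by
    intro x
    by_cases hx : x ∈ T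
    · rw [Set.indicator_of_mem hx]
      have hsub : Prod.mk x ⁻¹' S ⊆ ⋃ j : ℕ, {v : E d | a ≤ j * h ∧ ‖(ε * (j * h)) • v -
          (wrap L (Z.1 - x) + ((flow N η Φ ((Z, z) : Config d M) (ε * (j * h))).1.1 - Z.1))‖
            ≤ 2 * R} := by
        intro v hv
        have hv' : ((Z, Fin.cons (x, v) z) : Config d (M + 1)) ∈
            freeRecollision N η R Φ ε h a (M + 1) := hv
        obtain ⟨-, j, hj, hv⟩ := mem_freeRecollision_cons.1 hv'
        refine Set.mem_iUnion.2 ⟨j, hj, ?_⟩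
        rw [sub_sub] at hv
        exact hv
      refine (measure_mono hsub).trans ((measure_iUnion_le _).trans ?_)
      calc _ ≤ ∑' j : ℕ, volume (Metric.closedBall (0 : E d) (2 * R)) *
            (if a ≤ j * h then ENNReal.ofReal (((j * h) ^ d)⁻¹) else 0) := by
            refine ENNReal.tsum_le_tsum fun j => ?_
            by_cases hj : a ≤ j * h
            · simp only [hj, true_and, if_true]
              exact (volume_velocity_le hε (ha.trans_le hj) _).trans_eq (mul_comm _ _)
            · simp [hj]
        _ ≤ κ := by
            rw [ENNReal.tsum_mul_left, hκ]
            gcongr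
            exact tsum_inv_pow_le hh ha hd
    · rw [Set.indicator_of_notMem hx]
      have : Prod.mk x ⁻¹' S = ∅ := by
        ext v
        simp only [Set.mem_preimage, Set.mem_empty_iff_false, iff_false]
        intro hv
        have hv' : ((Z, Fin.cons (x, v) z) : Config d (M + 1)) ∈
            freeRecollision N η R Φ ε h a (M + 1) := hv
        exact hx (mem_freeRecollision_cons.1 hv').1
      rw [this, measure_empty]
  have hphase : phaseVolume d L S ≤ κ * (3 ^ d * volume (Metric.closedBall (0 : E d) (10 * R))) := by
    rw [phaseVolume, Measure.prod_apply hSm]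
    refine (lintegral_mono hslice).trans ?_
    rw [lintegral_indicator_const hTm, Measure.restrict_apply hTm]
    gcongr
    exact volume_cube_inter_le (hR.trans hRL) _ _
  calc _ ≤ ∫⁻ _ in S, ENNReal.ofReal (Real.exp b) ∂(phaseVolume d L) :=
        lintegral_mono fun z₀ => ENNReal.ofReal_le_ofReal (insertionDensity_le hb hN Z z₀)
    _ = ENNReal.ofReal (Real.exp b) * phaseVolume d L S := setLIntegral_const _ _
    _ ≤ ENNReal.ofReal (Real.exp b) *
        (κ * (3 ^ d * volume (Metric.closedBall (0 : E d) (10 * R)))) := by gcongr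
    _ = _ := by rw [hκ]; ring

end FreeRecollision

/-! ### Recolliding trajectories -/

section Trajectory

variable {d M N : ℕ} {η R : ℝ} {Φ : E d → ℝ} {γ : ℝ → Config d (M + 1)} {t ε : ℝ}

/-- The velocity of particle 1 relative to the tagged particle. -/
def relVel (c : Config d (M + 1)) : E d := (c.2 0).2 - c.1.2

/-- The position of particle 1 relative to the tagged particle at time `t + ε u`, followed
continuously from its representative on the torus at time `t`. -/
noncomputable def relDisp (L : ℝ) (γ : ℝ → Config d (M + 1)) (t ε u : ℝ) : E d :=
  (((γ (t + ε * u)).2 0).1 - (γ (t + ε * u)).1.1) - (((γ t).2 0).1 - (γ t).1.1)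
    - relPos L (γ t) 0

theorem relDisp_zero (L : ℝ) : relDisp L γ t ε 0 = -relPos L (γ t) 0 := by
  simp [relDisp]

theorem hasDerivAt_comp_affine {W : Type*} [NormedAddCommGroup W] [NormedSpace ℝ W] {f : ℝ → W}
    {f' : W} {u : ℝ} (h : HasDerivAt f f' (t + ε * u)) :
    HasDerivAt (fun u => f (t + ε * u)) (ε • f') u := by
  have h1 : HasDerivAt (fun u => t + ε * u) ε u := by
    simpa using ((hasDerivAt_id u).const_mul ε).const_add t
  exact h.scomp u h1

theorem hasDerivAt_relDisp (hγ : ∀ s, HasDerivAt γ (newtonField N η Φ (γ s)) s) (L u : ℝ) :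
    HasDerivAt (relDisp L γ t ε) (ε • relVel (γ (t + ε * u))) u := by
  have h := hγ (t + ε * u)
  have hx := hasDerivAt_comp_affine (ε := ε) (hasDerivAt_pi.1 h.snd 0).fst
  have hX := hasDerivAt_comp_affine (ε := ε) h.fst.fst
  have := ((hx.sub hX).sub_const (((γ t).2 0).1 - (γ t).1.1)).sub_const (relPos L (γ t) 0)
  rw [← smul_sub] at this
  exact this

/-- Before it moves around the torus, the relative position is the continuously followed one. -/
theorem relPos_eq_neg_relDisp {L u : ℝ} (hL : 0 < L) (hu : ‖relDisp L γ t ε u‖ < L) :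
    relPos L (γ (t + ε * u)) 0 = -relDisp L γ t ε u := by
  have h : (γ (t + ε * u)).1.1 - ((γ (t + ε * u)).2 0).1 = -relDisp L γ t ε u +
      latticeVec L fun j => round (((γ t).1.1 - ((γ t).2 0).1) j / (2 * L)) := by
    rw [relDisp, relPos, wrap_eq_sub_latticeVec]
    abel
  rw [relPos, h, wrap_add_latticeVec hL, wrap_eq_self hL (by rwa [norm_neg])]

theorem norm_relDisp_sub_le (hγ : ∀ s, HasDerivAt γ (newtonField N η Φ (γ s)) s) (hε : |ε| = 1)
    (L : ℝ) {a b C : ℝ} (hab : a ≤ b) (hC : ∀ u ∈ Set.Icc a b, ‖relVel (γ (t + ε * u))‖ ≤ C) :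
    ‖relDisp L γ t ε b - relDisp L γ t ε a‖ ≤ C * (b - a) := by
  have := Convex.norm_image_sub_le_of_norm_hasDerivWithin_le (s := Set.Icc a b) (C := C)
    (fun u _ => (hasDerivAt_relDisp (t := t) (ε := ε) hγ L u).hasDerivWithinAt)
    (fun u hu => by rw [norm_smul, Real.norm_eq_abs, hε, one_mul]; exact hC u hu)
    (convex_Icc a b) (Set.left_mem_Icc.2 hab) (Set.right_mem_Icc.2 hab)
  rwa [Real.norm_eq_abs, abs_of_nonneg (sub_nonneg.2 hab)] at this

/-- If the relative velocity is almost constant during a time `τ`, particle 1 leaves the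
interaction ball before time `σ` and does not come back before time `τ`. -/
theorem exists_first_return (hR : 0 < R) (hγ : ∀ s, HasDerivAt γ (newtonField N η Φ (γ s)) s)
    (hε : |ε| = 1) {L ρ σ τ S : ℝ} (hL : 0 < L)
    (h0 : ‖relPos L (γ t) 0‖ ≤ R) (hS : ‖relPos L (γ (t + ε * S)) 0‖ ≤ R)
    (hSL : ‖relDisp L γ t ε S‖ < L) (hρ : ρ = ‖relVel (γ t)‖)
    (hvel : ∀ u ∈ Set.Icc 0 τ, ‖relVel (γ (t + ε * u)) - relVel (γ t)‖ ≤ ρ / 10)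
    (hσ : 0 ≤ σ) (hσ1 : 3 * R ≤ ρ * σ) (hσ2 : ρ * σ ≤ 6 * R) (hστ : σ ≤ τ) (hσS : σ ≤ S) :
    ‖relDisp L γ t ε σ‖ ≤ 10 * R ∧ ∃ u, τ < u ∧ u ≤ S ∧ ‖relDisp L γ t ε u‖ ≤ R ∧
      ∀ u' ∈ Set.Ico σ u, R < ‖relDisp L γ t ε u'‖ := by
  have hder := fun u => hasDerivAt_relDisp (t := t) (ε := ε) hγ L u
  have happrox : ∀ u ∈ Set.Icc 0 τ,
      ‖relDisp L γ t ε u - (relDisp L γ t ε 0 + (ε * u) • relVel (γ t))‖ ≤ ρ / 10 * u := by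
    intro u hu
    have hd : ∀ s, HasDerivAt (fun s => relDisp L γ t ε s - (ε * s) • relVel (γ t))
        (ε • (relVel (γ (t + ε * s)) - relVel (γ t))) s := by
      intro s
      have h1 : HasDerivAt (fun s => (ε * s) • relVel (γ t)) (ε • relVel (γ t)) s := by
        simpa using ((hasDerivAt_id s).const_mul ε).smul_const (relVel (γ t))
      rw [smul_sub]
      exact (hder s).fun_sub h1
    have := Convex.norm_image_sub_le_of_norm_hasDerivWithin_le (s := Set.Icc 0 τ) (C := ρ / 10)
      (fun s _ => (hd s).hasDerivWithinAt)
      (fun s hs => by rw [norm_smul, Real.norm_eq_abs, hε, one_mul]; exact hvel s hs)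
      (convex_Icc 0 τ) (Set.left_mem_Icc.2 (hu.1.trans hu.2)) hu
    simp only [mul_zero, zero_smul, sub_zero, Real.norm_eq_abs, abs_of_nonneg hu.1] at this
    rwa [sub_right_comm, sub_sub] at this
  have hlin : ∀ u, 0 ≤ u → ‖(ε * u) • relVel (γ t)‖ = ρ * u := by
    intro u hu
    rw [norm_smul, Real.norm_eq_abs, abs_mul, hε, one_mul, abs_of_nonneg hu, hρ, mul_comm]
  have hy0 : ‖relDisp L γ t ε 0‖ ≤ R := by rwa [relDisp_zero, norm_neg]
  have hρ0 : 0 ≤ ρ := hρ ▸ norm_nonneg _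
  have hout : ∀ u ∈ Set.Icc σ τ, R < ‖relDisp L γ t ε u‖ := by
    intro u hu
    have hu0 : 0 ≤ u := hσ.trans hu.1
    have h1 := happrox u ⟨hu0, hu.2⟩
    have h2 := hlin u hu0
    have h3 : ρ * σ ≤ ρ * u := by gcongr; exact hu.1
    have h4 : ‖(ε * u) • relVel (γ t)‖ ≤
        ‖relDisp L γ t ε u - (relDisp L γ t ε 0 + (ε * u) • relVel (γ t))‖ +
          ‖relDisp L γ t ε u‖ + ‖relDisp L γ t ε 0‖ := by
      calc _ = ‖-(relDisp L γ t ε u - (relDisp L γ t ε 0 + (ε * u) • relVel (γ t))) +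
            relDisp L γ t ε u - relDisp L γ t ε 0‖ := by congr 1; abel
        _ ≤ _ := by
          refine (norm_sub_le _ _).trans ?_
          gcongr
          refine (norm_add_le _ _).trans ?_
          rw [norm_neg]
    linarith
  constructor
  · have h1 := happrox σ ⟨hσ, hστ⟩
    have h2 := hlin σ hσ
    have h3 := norm_le_norm_add_norm_sub' (relDisp L γ t ε σ)
      (relDisp L γ t ε 0 + (ε * σ) • relVel (γ t))
    have h4 := norm_add_le (relDisp L γ t ε 0) ((ε * σ) • relVel (γ t))
    linarith
  · have hcont : Continuous (relDisp L γ t ε) :=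
      continuous_iff_continuousAt.2 fun u => (hder u).continuousAt
    have hSR : ‖relDisp L γ t ε S‖ ≤ R := by
      rwa [relPos_eq_neg_relDisp hL hSL, norm_neg] at hS
    set A : Set ℝ := Set.Icc σ S ∩ {u | ‖relDisp L γ t ε u‖ ≤ R} with hA
    have hAc : IsCompact A :=
      isCompact_Icc.inter_right (isClosed_le hcont.norm continuous_const)
    obtain ⟨u, hu, humin⟩ := hAc.exists_isLeast ⟨S, ⟨⟨hσS, le_rfl⟩, hSR⟩⟩
    refine ⟨u, ?_, hu.1.2, hu.2, fun u' hu' => ?_⟩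
    · by_contra hle
      exact absurd hu.2 (not_le.2 (hout u ⟨hu.1.1, not_lt.1 hle⟩))
    · by_contra hle
      have := humin ⟨⟨hu'.1, hu'.2.le.trans hu.1.2⟩, not_lt.1 hle⟩
      exact absurd hu'.2 (not_lt.2 this)

/-- When particle 1 is outside the interaction ball, the other particles do not feel it. -/
theorem removeFirst_newtonField (hsupp : Function.support Φ ⊆ Metric.closedBall 0 R)
    {c : Config d (M + 1)} (hc : R < ‖relPos (halfSide N η) c 0‖) :
    removeFirst (newtonField N η Φ c) = newtonField N η Φ (removeFirst c) := by
  simp only [newtonField, removeFirst, Fin.sum_univ_succ, gradient_eq_zero_of_lt hsupp hc, zero_add]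
  rfl

theorem hasDerivAt_removeFirst {c' : Config d (M + 1)} {f : ℝ → Config d (M + 1)} {u : ℝ}
    (h : HasDerivAt f c' u) : HasDerivAt (fun u => removeFirst (f u)) (removeFirst c') u := by
  have h1 : HasDerivAt (fun u => (f u).1) c'.1 u := h.fst
  have h2 : HasDerivAt (fun u => fun i : Fin M => (f u).2 i.succ) (fun i => c'.2 i.succ) u :=
    hasDerivAt_pi.2 fun i => hasDerivAt_pi.1 h.snd i.succ
  exact h1.prodMk h2

/-- If particle 1 stays outside of the interaction ball between the times `t + ε σ` and `t + ε u`
and meets the tagged particle at the latter time, then at time `t + ε σ` the configuration is in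
`freeRecollision`: particle 1 moves freely, and the tagged particle moves as if it were absent. -/
theorem mem_freeRecollision_of_return (hR : 0 < R) (hΦ : ContDiff ℝ 3 Φ)
    (hsupp : Function.support Φ ⊆ Metric.closedBall 0 R) (hRL : R < halfSide N η)
    (hγ : ∀ s, HasDerivAt γ (newtonField N η Φ (γ s)) s) (hε : |ε| = 1) {σ u h a W : ℝ}
    (hσu : σ ≤ u) (hσR : ‖relDisp (halfSide N η) γ t ε σ‖ ≤ 10 * R)
    (hu : ‖relDisp (halfSide N η) γ t ε u‖ ≤ R)
    (hout : ∀ u' ∈ Set.Ico σ u, R < ‖relDisp (halfSide N η) γ t ε u'‖)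
    (hlt : ∀ u' ∈ Set.Icc σ u, ‖relDisp (halfSide N η) γ t ε u'‖ < halfSide N η)
    (hh : 0 < h) (hW : ∀ u' ∈ Set.Icc σ u, ‖relVel (γ (t + ε * u'))‖ ≤ W) (hhW : h * W ≤ R)
    (ha : a ≤ u - σ - h) :
    γ (t + ε * σ) ∈ freeRecollision N η R Φ ε h a (M + 1) := by
  set L := halfSide N η with hL
  have hL0 : 0 < L := hR.trans hRL
  set j := ⌊(u - σ) / h⌋₊ with hj
  have hj1 : j * h ≤ u - σ :=
    (le_div_iff₀ hh).1 (Nat.floor_le (div_nonneg (sub_nonneg.2 hσu) hh.le))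
  have hj2 : u - σ < (j + 1) * h := (div_lt_iff₀ hh).1 (Nat.lt_floor_add_one _)
  set s : ℝ := j * h with hs
  have hs0 : 0 ≤ s := by positivity
  have hrel : ∀ u' ∈ Set.Icc σ u, relPos L (γ (t + ε * u')) 0 = -relDisp L γ t ε u' :=
    fun u' hu' => relPos_eq_neg_relDisp hL0 (hlt u' hu')
  have hmem : ∀ r ∈ Set.Ico 0 s, R < ‖relPos L (γ (t + ε * (σ + r))) 0‖ := by
    intro r hr
    rw [hrel _ ⟨by linarith [hr.1], by linarith [hr.2]⟩, norm_neg]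
    exact hout _ ⟨by linarith [hr.1], by linarith [hr.2]⟩
  have hshift : ∀ r, HasDerivAt (fun r => γ (t + ε * (σ + r)))
      (ε • newtonField N η Φ (γ (t + ε * (σ + r)))) r := by
    intro r
    have h1 : ∀ r, t + ε * (σ + r) = (t + ε * σ) + ε * r := fun r => by ring
    simp only [h1]
    exact hasDerivAt_comp_affine (hγ _)
  -- the other particles follow the dynamics without particle 1
  obtain ⟨Λ, hΛ⟩ := exists_lipschitzWith_newtonField (M := M) hR hΦ hsupp hRL
  set c' := removeFirst (γ (t + ε * σ)) with hc'
  have hflow := isTrajectory_flow hR hΦ hsupp hRL c'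
  have hred : removeFirst (γ (t + ε * (σ + s))) = flow N η Φ c' (ε * s) := by
    have hf : ∀ r, HasDerivAt (fun r => removeFirst (γ (t + ε * (σ + r))))
        (removeFirst (ε • newtonField N η Φ (γ (t + ε * (σ + r))))) r :=
      fun r => hasDerivAt_removeFirst (hshift r)
    have hg : ∀ r, HasDerivAt (fun r => flow N η Φ c' (ε * r))
        (ε • newtonField N η Φ (flow N η Φ c' (ε * r))) r := by
      intro r
      have := hasDerivAt_comp_affine (t := 0) (ε := ε) (u := r) (hflow.2 _)
      simpa only [zero_add] using this
    have hv : ∀ _ : ℝ, LipschitzWith (‖ε‖₊ * Λ) fun c : Config d M => ε • newtonField N η Φ c :=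
      fun _ => (lipschitzWith_smul ε).comp hΛ
    refine ODE_solution_unique (a := 0) (b := s) hv
      (continuous_iff_continuousAt.2 fun r => (hf r).continuousAt).continuousOn ?_
      (continuous_iff_continuousAt.2 fun r => (hg r).continuousAt).continuousOn
      (fun r _ => (hg r).hasDerivWithinAt) ?_ ⟨hs0, le_rfl⟩
    · intro r hr
      have h1 : removeFirst (ε • newtonField N η Φ (γ (t + ε * (σ + r)))) =
          ε • newtonField N η Φ (removeFirst (γ (t + ε * (σ + r)))) := by
        rw [← removeFirst_newtonField hsupp (hmem r hr)]; rfl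
      rw [← h1]
      exact (hf r).hasDerivWithinAt
    · simp only [add_zero, mul_zero, hflow.1]
      rfl
  -- particle 1 moves freely
  have hvel : ∀ r ∈ Set.Icc 0 s, ((γ (t + ε * (σ + r))).2 0).2 = ((γ (t + ε * σ)).2 0).2 := by
    have hd : ∀ r, HasDerivAt (fun r => ((γ (t + ε * (σ + r))).2 0).2)
        (ε • ((N : ℝ)⁻¹ • gradient Φ (relPos L (γ (t + ε * (σ + r))) 0))) r :=
      fun r => (hasDerivAt_pi.1 (hshift r).snd 0).snd
    intro r hr
    have := constant_of_has_deriv_right_zero (a := 0) (b := s)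
      (continuous_iff_continuousAt.2 fun r => (hd r).continuousAt).continuousOn
      (fun r hr => by
        have := (hd r).hasDerivWithinAt (s := Set.Ici r)
        rwa [gradient_eq_zero_of_lt hsupp (hmem r hr), smul_zero, smul_zero] at this) r hr
    simpa using this
  have hpos : ((γ (t + ε * (σ + s))).2 0).1 =
      ((γ (t + ε * σ)).2 0).1 + (ε * s) • ((γ (t + ε * σ)).2 0).2 := by
    have hd : ∀ r, HasDerivAt (fun r => ((γ (t + ε * (σ + r))).2 0).1 -
        (ε * r) • ((γ (t + ε * σ)).2 0).2)
        (ε • ((γ (t + ε * (σ + r))).2 0).2 - ε • ((γ (t + ε * σ)).2 0).2) r := by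
      intro r
      have h1 : HasDerivAt (fun r => (ε * r) • ((γ (t + ε * σ)).2 0).2)
          (ε • ((γ (t + ε * σ)).2 0).2) r := by
        simpa using ((hasDerivAt_id r).const_mul ε).smul_const ((γ (t + ε * σ)).2 0).2
      exact HasDerivAt.fun_sub (hasDerivAt_pi.1 (hshift r).snd 0).fst h1
    have := constant_of_has_deriv_right_zero (a := 0) (b := s)
      (continuous_iff_continuousAt.2 fun r => (hd r).continuousAt).continuousOn
      (fun r hr => by
        have := (hd r).hasDerivWithinAt (s := Set.Ici r)
        rwa [hvel r ⟨hr.1, hr.2.le⟩, sub_self] at this) s ⟨hs0, le_rfl⟩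
    simp only [add_zero, mul_zero, zero_smul, sub_zero] at this
    rw [← this]; abel
  have hX : (flow N η Φ c' (ε * s)).1.1 = (γ (t + ε * (σ + s))).1.1 := by
    rw [← hred]; rfl
  refine mem_freeRecollision_succ.2 ⟨?_, j, by linarith, ?_⟩
  · rw [hrel σ ⟨le_rfl, hσu⟩, norm_neg]; exact hσR
  · have e : (ε * s) • ((γ (t + ε * σ)).2 0).2 - relPos L (γ (t + ε * σ)) 0 -
        ((flow N η Φ c' (ε * s)).1.1 - (γ (t + ε * σ)).1.1) = relDisp L γ t ε (σ + s) := by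
      rw [hX, hrel σ ⟨le_rfl, hσu⟩, relDisp, relDisp, hpos]
      abel
    rw [e]
    have h1 := norm_relDisp_sub_le (t := t) hγ hε L (a := σ + s) (b := u) (C := W) (by linarith)
      fun u' hu' => hW u' ⟨by linarith [hu'.1], hu'.2⟩
    have h2 := norm_le_norm_add_norm_sub (relDisp L γ t ε u) (relDisp L γ t ε (σ + s))
    have hW0 : 0 ≤ W := (norm_nonneg _).trans (hW u ⟨hσu, le_rfl⟩)
    have h3 : W * (u - (σ + s)) ≤ W * h := by gcongr; linarith
    linarith [mul_comm h W]

/-! ### Control of the velocities -/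

theorem norm_le_card_mul {z : E d} {b : ℝ} (hz : ∀ j, |z j| ≤ b) (hd : 0 < d) :
    ‖z‖ ≤ d * b := by
  have hb : 0 ≤ b := (abs_nonneg _).trans (hz ⟨0, hd⟩)
  have hd1 : (1 : ℝ) ≤ d := by exact_mod_cast hd
  rw [EuclideanSpace.norm_eq]
  refine Real.sqrt_le_iff.2 ⟨by positivity, ?_⟩
  calc ∑ j, ‖z j‖ ^ 2 ≤ ∑ _j : Fin d, b ^ 2 := by
        gcongr with j; exact hz j
    _ = d * b ^ 2 := by simp
    _ ≤ d * (d * b ^ 2) := le_mul_of_one_le_left (by positivity) hd1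
    _ = _ := by ring

theorem partialDeriv_one (I : Fin 1 → Fin d) (y : E d) :
    partialDeriv I Φ y = gradient Φ y (I 0) := by
  rw [partialDeriv, iteratedFDeriv_one_apply, gradient]
  have h := InnerProductSpace.toDual_symm_apply (𝕜 := ℝ) (x := EuclideanSpace.single (I 0) (1 : ℝ))
    (y := fderiv ℝ Φ y)
  rw [← h, EuclideanSpace.inner_single_right]
  simp

/-- The increments of the velocity of the tagged particle, from the bound on the time integrals of
the force. -/
theorem norm_tagged_velocity_sub_le (hd : 0 < d) (hR : 0 < R) (hΦ : ContDiff ℝ 3 Φ)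
    (hsupp : Function.support Φ ⊆ Metric.closedBall 0 R) (hRL : R < halfSide N η)
    {M : ℕ} {γ : ℝ → Config d M} (hγ : ∀ s, HasDerivAt γ (newtonField N η Φ (γ s)) s) {s t b : ℝ}
    (hb : ∀ I : Fin 1 → Fin d,
      |1 / (N : ℝ) * ∫ u in s..t, derivSum (halfSide N η) Φ I (γ u)| ≤ b) :
    ‖(γ t).1.2 - (γ s).1.2‖ ≤ d * b := by
  refine norm_le_card_mul (fun j => ?_) hd
  refine le_of_eq_of_le ?_ (hb fun _ => j)
  have hγc : Continuous γ := continuous_iff_continuousAt.2 fun u => (hγ u).continuousAt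
  have hG := continuous_comp_wrap hR hRL (fun y hy => gradient_eq_zero_of_lt hsupp hy)
    (contDiff_gradient hΦ).continuous
  have hcont : Continuous fun u => derivSum (halfSide N η) Φ (fun _ : Fin 1 => j) (γ u) := by
    simp only [derivSum, partialDeriv_one, relPos]
    refine continuous_finsetSum _ fun i _ => ?_
    have h1 : Continuous fun u => (γ u).1.1 - ((γ u).2 i).1 := by fun_prop
    exact (EuclideanSpace.proj (𝕜 := ℝ) j).continuous.comp (hG.comp h1)
  have hder : ∀ u, HasDerivAt (fun u => (γ u).1.2 j)
      (-(1 / (N : ℝ) * derivSum (halfSide N η) Φ (fun _ : Fin 1 => j) (γ u))) u := by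
    intro u
    have h := (EuclideanSpace.proj j : E d →L[ℝ] ℝ).hasFDerivAt.comp_hasDerivAt u (hγ u).fst.snd
    refine h.congr_deriv ?_
    simp [newtonField, derivSum, partialDeriv_one]
  have := intervalIntegral.integral_eq_sub_of_hasDerivAt (fun u _ => hder u)
    ((continuous_const.mul hcont).neg.intervalIntegrable s t)
  rw [intervalIntegral.integral_neg, intervalIntegral.integral_const_mul] at this
  rw [← abs_neg (1 / (N : ℝ) * _), this]
  rfl

/-- The velocity of a background particle has increments of order `1 / N`. -/
theorem norm_background_velocity_sub_le {B : ℝ} (hB : ∀ y, ‖gradient Φ y‖ ≤ B) {M : ℕ}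
    {γ : ℝ → Config d M} (hγ : ∀ s, HasDerivAt γ (newtonField N η Φ (γ s)) s) (i : Fin M)
    (s t : ℝ) : ‖((γ t).2 i).2 - ((γ s).2 i).2‖ ≤ (N : ℝ)⁻¹ * B * |t - s| := by
  have hd : ∀ u, HasDerivAt (fun u => ((γ u).2 i).2)
      ((N : ℝ)⁻¹ • gradient Φ (relPos (halfSide N η) (γ u) i)) u :=
    fun u => (hasDerivAt_pi.1 (hγ u).snd i).snd
  refine Convex.norm_image_sub_le_of_norm_hasDerivWithin_le (s := Set.univ)
    (fun u _ => (hd u).hasDerivWithinAt) (fun u _ => ?_) convex_univ (Set.mem_univ s)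
    (Set.mem_univ t)
  rw [norm_smul, Real.norm_eq_abs, abs_of_nonneg (by positivity)]
  gcongr
  exact hB _

end Trajectory

/-! ### Covering of the recollision event -/

section Covering

variable {d N : ℕ} {η R : ℝ} {Φ : E d → ℝ} {Cint K m δ α β : ℝ}

theorem exists_dyadic {g ρ : ℝ} (hg : 0 < g) (hρ : g ≤ ρ) :
    ∃ k : ℕ, 2 ^ k * g ≤ ρ ∧ ρ < 2 * (2 ^ k * g) := by
  obtain ⟨k, h1, h2⟩ := exists_nat_pow_near ((one_le_div hg).2 hρ) (by norm_num : (1 : ℝ) < 2)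
  refine ⟨k, (le_div_iff₀ hg).1 h1, ?_⟩
  rw [div_lt_iff₀ hg, pow_succ] at h2
  linarith

/-- On the better set, the relative velocity of particle 1 varies little. -/
theorem norm_relVel_sub_le (hd : 0 < d) (hR : 0 < R) (hΦ : ContDiff ℝ 3 Φ)
    (hsupp : Function.support Φ ⊆ Metric.closedBall 0 R) (hRL : R < halfSide N η)
    {B : ℝ} (hB : ∀ y, ‖gradient Φ y‖ ≤ B) {M : ℕ} {c : Config d (M + 1)}
    (hω : (⟨M + 1, c⟩ : GrandConfig d) ∈ betterSet N η R Φ Cint K m δ α β) {ε t u : ℝ}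
    (hε : |ε| = 1) (ht : t ∈ Set.Icc (-(N : ℝ)) N) (hu : 0 ≤ u) (huN : u ≤ N)
    (huβ : u ≤ (N : ℝ) ^ β) :
    ‖relVel (flow N η Φ c (t + ε * u)) - relVel (flow N η Φ c t)‖ ≤
      d * (|K| * (Real.sqrt (u / N) * (N : ℝ) ^ α)) + (N : ℝ)⁻¹ * B * u := by
  have hγ := (isTrajectory_flow hR hΦ hsupp hRL c).2
  have habs : |t + ε * u - t| = u := by
    rw [add_sub_cancel_left, abs_mul, hε, one_mul, abs_of_nonneg hu]
  have hεu : |ε * u| ≤ N := by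
    rw [abs_mul, hε, one_mul, abs_of_nonneg hu]; exact huN
  rw [abs_le] at hεu
  have hV := norm_tagged_velocity_sub_le hd hR hΦ hsupp hRL hγ (s := t) (t := t + ε * u)
    (b := |K| * (Real.sqrt (u / N) * (N : ℝ) ^ α)) fun I => by
      have h := (hω.2 t ⟨by linarith [ht.1, ht.2], by linarith [ht.1, ht.2]⟩ (t + ε * u)
        ⟨by linarith [ht.1, ht.2], by linarith [ht.1, ht.2]⟩ (by rwa [habs]) 1 le_rfl
        (by norm_num) I).1
      rw [habs] at h
      exact h.trans (by gcongr; exact le_abs_self K)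
  have hv := norm_background_velocity_sub_le hB hγ 0 t (t + ε * u)
  rw [habs] at hv
  calc _ = ‖(((flow N η Φ c (t + ε * u)).2 0).2 - ((flow N η Φ c t).2 0).2) -
        ((flow N η Φ c (t + ε * u)).1.2 - (flow N η Φ c t).1.2)‖ := by
        unfold relVel; congr 1; abel
    _ ≤ _ := (norm_sub_le _ _).trans (by linarith)

/-- The recollision event is covered by the events that, shortly after or before time `t`,
particle 1 has a free recollision: the relevant delay is of the order of the time needed to leave
the interaction ball, for one of the dyadic values `2 ^ k g` of the relative speed.

The first grid of times is used for slow particles, which recollide after a time `τ₀`; the second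
one, which is finer since only the crude bound `N ^ (1/2)` on the speeds is available, for
recollisions after a time `T`. -/
theorem recollision_subset (hd : 0 < d) (hR : 0 < R) (hΦ : ContDiff ℝ 3 Φ)
    (hsupp : Function.support Φ ⊆ Metric.closedBall 0 R) (hN : 0 < N)
    {B : ℝ} (hB : ∀ y, ‖gradient Φ y‖ ≤ B) {g τ₀ T : ℝ} (hg : 0 < g)
    (hwrap : R + 2 * (N : ℝ) ^ (1 / 2 : ℝ) * (2 * N) < halfSide N η) (h10 : 10 * R < halfSide N η)
    (hslow : ∀ u ∈ Set.Icc 0 τ₀,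
      d * (|K| * (Real.sqrt (u / N) * (N : ℝ) ^ α)) + (N : ℝ)⁻¹ * B * u ≤ g / 10)
    (hfast : ∀ u ∈ Set.Icc 0 T,
      d * (|K| * (Real.sqrt (u / N) * (N : ℝ) ^ α)) + (N : ℝ)⁻¹ * B * u ≤ 1 / 10)
    (hτ : 3 * R / g + R / 2 ≤ τ₀ / 2) (hT : 3 * R / g + R ≤ T / 2) (hτT : τ₀ ≤ T) (hTN : T ≤ N)
    (hTβ : T ≤ (N : ℝ) ^ β) (hgN : (N : ℝ) ^ (1 / 2 : ℝ) ≤ g * N) {t : ℝ}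
    (ht : t ∈ Set.Icc (-(N : ℝ)) N) :
    betterSet N η R Φ Cint K m δ α β ∩ (recollision N η R Φ t ∩ fastAt N η Φ g t) ⊆
      ⋃ k ∈ Finset.range (Nat.log 2 N + 2), ⋃ ε ∈ ({1, -1} : Finset ℝ),
        ({ω | flow N η Φ ω.2 (t + ε * (3 * R / (2 ^ k * g))) ∈
            freeRecollision N η R Φ ε (R / 2) (τ₀ / 2) ω.1} ∪
          {ω | flow N η Φ ω.2 (t + ε * (3 * R / (2 ^ k * g))) ∈
            freeRecollision N η R Φ ε (R / (2 * (N : ℝ) ^ (1 / 2 : ℝ))) (T / 2) ω.1}) := by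
  rintro ⟨M, c⟩ ⟨hω, ⟨hM, ⟨s, hs, hsep, hret⟩, hin⟩, ⟨_, hgρ⟩⟩
  obtain ⟨M, rfl⟩ : ∃ M', M = M' + 1 := ⟨M - 1, by have : 0 < M := hM; omega⟩
  have hRL : R < halfSide N η := by linarith
  have hL0 : 0 < halfSide N η := hR.trans hRL
  have hN1 : (1 : ℝ) ≤ N := by exact_mod_cast hN
  set q := (N : ℝ) ^ (1 / 2 : ℝ) with hq
  have hq1 : 1 ≤ q := Real.one_le_rpow hN1 (by norm_num)
  set γ := flow N η Φ c with hγdef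
  have hγ : ∀ s, HasDerivAt γ (newtonField N η Φ (γ s)) s :=
    (isTrajectory_flow hR hΦ hsupp hRL c).2
  set ρ := ‖relVel (γ t)‖ with hρ
  change g ≤ ρ at hgρ
  change 6 * R / ρ ≤ |s - t| at hsep
  change ‖relPos (halfSide N η) (γ s) 0‖ ≤ R at hret
  change ‖relPos (halfSide N η) (γ t) 0‖ ≤ R at hin
  have hρ0 : 0 < ρ := hg.trans_le hgρ
  -- the direction of time and the delay of the recollision
  obtain ⟨ε, hεmem, hε, hs_eq⟩ : ∃ ε ∈ ({1, -1} : Finset ℝ), |ε| = 1 ∧ s = t + ε * |s - t| := by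
    rcases le_total t s with h | h
    · exact ⟨1, by simp, by simp, by rw [abs_of_nonneg (sub_nonneg.2 h)]; ring⟩
    · exact ⟨-1, by simp, by simp, by rw [abs_of_nonpos (sub_nonpos.2 h)]; ring⟩
  set S := |s - t| with hS
  have hS0 : 0 ≤ S := abs_nonneg _
  have hS2 : S ≤ 2 * N := abs_le.2 ⟨by linarith [ht.2, hs.1], by linarith [ht.1, hs.2]⟩
  have htime : ∀ u ∈ Set.Icc 0 S, t + ε * u ∈ Set.Icc (-(2 * N : ℝ)) (2 * N) := by
    intro u hu
    rcases (by simpa using hεmem : ε = 1 ∨ ε = -1) with rfl | rfl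
    · constructor <;> linarith [hu.1, hu.2, ht.1, ht.2, hs.1, hs.2]
    · constructor <;> linarith [hu.1, hu.2, ht.1, ht.2, hs.1, hs.2]
  have hspeed : ∀ u ∈ Set.Icc 0 S, ‖relVel (γ (t + ε * u))‖ ≤ 2 * q := by
    intro u hu
    have hgood := hω.1.2 _ (htime u hu)
    have h1 := hgood.tagged_speed
    have h2 := hgood.background_speed 0
    exact (norm_sub_le _ _).trans (by linarith)
  have hdispL : ∀ u ∈ Set.Icc 0 S, ‖relDisp (halfSide N η) γ t ε u‖ < halfSide N η := by
    intro u hu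
    have h1 := norm_relDisp_sub_le (t := t) hγ hε (halfSide N η) hu.1
      fun u' hu' => hspeed u' ⟨hu'.1, hu'.2.trans hu.2⟩
    have h2 := norm_le_norm_add_norm_sub' (relDisp (halfSide N η) γ t ε u)
      (relDisp (halfSide N η) γ t ε 0)
    rw [relDisp_zero, norm_neg] at h2
    rw [relDisp_zero, sub_zero] at h1
    have h3 : 2 * q * u ≤ 2 * q * (2 * N) := by gcongr; exact hu.2.trans hS2
    linarith
  have hvel : ∀ u, 0 ≤ u → u ≤ T → ‖relVel (γ (t + ε * u)) - relVel (γ t)‖ ≤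
      d * (|K| * (Real.sqrt (u / N) * (N : ℝ) ^ α)) + (N : ℝ)⁻¹ * B * u := fun u hu huT =>
    norm_relVel_sub_le hd hR hΦ hsupp hRL hB hω hε ht hu (huT.trans hTN) (huT.trans hTβ)
  -- the dyadic scale of the relative speed and the corresponding delay
  obtain ⟨k, hk1, hk2⟩ := exists_dyadic hg hgρ
  have hkpos : 0 < 2 ^ k * g := by positivity
  set σ := 3 * R / (2 ^ k * g) with hσ
  have hσ0 : 0 ≤ σ := by positivity
  have hσ1 : 3 * R ≤ ρ * σ := by
    rw [hσ, mul_div_assoc', le_div_iff₀ hkpos, mul_comm]; gcongr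
  have hσ2 : ρ * σ ≤ 6 * R := by
    rw [hσ, mul_div_assoc', div_le_iff₀ hkpos]
    nlinarith
  have hσS : σ ≤ S := by
    refine le_trans ?_ hsep
    rw [le_div_iff₀ hρ0, mul_comm]; exact hσ2
  have hσg : σ ≤ 3 * R / g := by
    rw [hσ]
    gcongr
    exact le_mul_of_one_le_left hg.le (one_le_pow₀ one_le_two)
  have hkrange : k ∈ Finset.range (Nat.log 2 N + 2) := by
    have h1 : (2 : ℝ) ^ k * g ≤ 2 * N * g := by
      have := hspeed 0 ⟨le_rfl, hS0⟩
      simp only [mul_zero, add_zero] at this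
      linarith
    have h2 : (2 : ℝ) ^ k ≤ 2 * N := le_of_mul_le_mul_right h1 hg
    have h3 : 2 ^ k ≤ N * 2 := by
      have : ((2 ^ k : ℕ) : ℝ) ≤ ((N * 2 : ℕ) : ℝ) := by push_cast; linarith
      exact_mod_cast this
    have h4 := Nat.le_log_of_pow_le one_lt_two h3
    rw [Nat.log_mul_base one_lt_two hN.ne'] at h4
    rw [Finset.mem_range]; omega
  simp only [Set.mem_iUnion, exists_prop]
  refine ⟨k, hkrange, ε, hεmem, ?_⟩
  have hret' : ‖relPos (halfSide N η) (γ (t + ε * S)) 0‖ ≤ R := by rw [← hs_eq]; exact hret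
  -- a late recollision is covered by the second grid
  have hlate : ‖relDisp (halfSide N η) γ t ε σ‖ ≤ 10 * R → ∀ u, T ≤ u → u ≤ S →
      ‖relDisp (halfSide N η) γ t ε u‖ ≤ R →
      (∀ u' ∈ Set.Ico σ u, R < ‖relDisp (halfSide N η) γ t ε u'‖) →
      γ (t + ε * σ) ∈ freeRecollision N η R Φ ε (R / (2 * q)) (T / 2) (M + 1) := by
    intro hσR u hTu huS huR hout
    have hq2 : R / (2 * q) ≤ R := div_le_self hR.le (by linarith)
    exact mem_freeRecollision_of_return hR hΦ hsupp hRL hγ hε (by linarith) hσR huR hout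
      (fun u' hu' => hdispL u' ⟨hσ0.trans hu'.1, hu'.2.trans huS⟩) (by positivity)
      (fun u' hu' => hspeed u' ⟨hσ0.trans hu'.1, hu'.2.trans huS⟩)
      (div_mul_cancel₀ R (by positivity)).le (by linarith)
  rcases lt_or_ge ρ 1 with hρ1 | hρ1
  · obtain ⟨hσR, u, hτu, huS, huR, hout⟩ := exists_first_return (τ := τ₀) hR hγ hε hL0 hin hret'
      (hdispL S ⟨hS0, le_rfl⟩) hρ
      (fun u hu => (hvel u hu.1 (hu.2.trans hτT)).trans ((hslow u hu).trans (by linarith)))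
      hσ0 hσ1 hσ2 (by linarith) hσS
    rcases le_total T u with hTu | huT
    · exact Or.inr (hlate hσR u hTu huS huR hout)
    · left
      refine mem_freeRecollision_of_return (W := 2) hR hΦ hsupp hRL hγ hε (by linarith) hσR huR hout
        (fun u' hu' => hdispL u' ⟨hσ0.trans hu'.1, hu'.2.trans huS⟩) (by positivity)
        (fun u' hu' => ?_) (by linarith) (by linarith)
      have hu'0 : 0 ≤ u' := hσ0.trans hu'.1
      have h1 := (hvel u' hu'0 (hu'.2.trans huT)).trans (hfast u' ⟨hu'0, hu'.2.trans huT⟩)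
      have h2 := norm_le_norm_add_norm_sub' (relVel (γ (t + ε * u'))) (relVel (γ t))
      linarith
  · obtain ⟨hσR, u, hTu, huS, huR, hout⟩ := exists_first_return (τ := T) hR hγ hε hL0 hin hret'
      (hdispL S ⟨hS0, le_rfl⟩) hρ
      (fun u hu => (hvel u hu.1 hu.2).trans ((hfast u hu).trans (by linarith)))
      hσ0 hσ1 hσ2 (by linarith) hσS
    exact Or.inr (hlate hσR u hTu.le huS huR hout)

end Covering

/-! ### Exponents -/

section Exponents

open Filter

theorem eventually_le_natCast_rpow (C : ℝ) {p : ℝ} (hp : 0 < p) :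
    ∀ᶠ N : ℕ in atTop, C ≤ (N : ℝ) ^ p :=
  ((tendsto_rpow_atTop hp).comp tendsto_natCast_atTop_atTop).eventually_ge_atTop C

theorem eventually_natLog_le_rpow {p : ℝ} (hp : 0 < p) :
    ∀ᶠ N : ℕ in atTop, ((Nat.log 2 N + 2 : ℕ) : ℝ) ≤ (N : ℝ) ^ p := by
  have h1 := ((isLittleO_log_rpow_atTop hp).comp_tendsto
    (tendsto_natCast_atTop_atTop (R := ℝ))).bound (by norm_num : (0 : ℝ) < 1 / 4)
  filter_upwards [h1, eventually_le_natCast_rpow 4 hp, eventually_ge_atTop 1] with N h h4 hN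
  have hN0 : (0 : ℝ) < N := by exact_mod_cast hN
  have hx : (0 : ℝ) ≤ (N : ℝ) ^ p := by positivity
  simp only [Function.comp, Real.norm_eq_abs, abs_of_nonneg hx] at h
  have h2 : ((Nat.log 2 N : ℕ) : ℝ) ≤ Real.logb 2 N := by
    exact_mod_cast Real.natLog_le_logb N 2
  have h3 : Real.logb 2 N ≤ 2 * Real.log N := by
    rw [Real.logb, div_le_iff₀ (Real.log_pos one_lt_two)]
    have := Real.log_two_gt_d9
    have h5 : 0 ≤ Real.log N := Real.log_nonneg (by exact_mod_cast hN)
    nlinarith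
  have h6 := le_abs_self (Real.log N)
  push_cast
  linarith

variable {d : ℕ} {δ : ℝ}

/-- The exponent `α*` is at most `1 / 24 + δ`; this is where `d ≥ 4` enters. -/
theorem one_div_four_mul_le (hd : 4 ≤ d) : 1 / (4 * ((d : ℝ) + 2)) ≤ 1 / 24 := by
  have hd' : (4 : ℝ) ≤ d := by exact_mod_cast hd
  rw [div_le_div_iff₀ (by positivity) (by norm_num)]
  linarith

theorem alphaStar_pos (hδ : 0 < δ) : 0 < alphaStar d δ := by
  unfold alphaStar; positivity

theorem five_ninths_le_betaStar (hd : 4 ≤ d) (hδ : δ ≤ 1 / 36) : 5 / 9 ≤ betaStar d δ := by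
  have hd' : (4 : ℝ) ≤ d := by exact_mod_cast hd
  have : 7 / 12 ≤ (2 * (d : ℝ) ^ 2 + 5 * d + 4) / (2 * ((d : ℝ) + 2) * ((d : ℝ) + 4)) := by
    rw [div_le_div_iff₀ (by norm_num) (by positivity)]
    nlinarith
  unfold betaStar
  linarith

/-- The times after `τ₀ ~ N ^ (4/9 - 2 α*)` on a grid of constant step contribute `τ₀ ^ (-(d - 1))`. -/
theorem slow_exponent_le (hd : 4 ≤ d) :
    -(4 / 9 - 2 * alphaStar d δ) * ((d - 1 : ℕ) : ℝ) ≤ -(13 / 12) + 2 * ((d : ℝ) - 1) * δ := by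
  have hd' : (4 : ℝ) ≤ d := by exact_mod_cast hd
  have h := one_div_four_mul_le hd
  rw [Nat.cast_sub (by omega), Nat.cast_one]
  unfold alphaStar
  nlinarith

/-- The times after `N ^ (5/9)` on a grid of step `N ^ (-1/2)` contribute at most `N ^ (-7/6)`. -/
theorem fast_exponent_le (hd : 4 ≤ d) (hδ : 0 < δ) :
    1 / 2 + -(5 / 9) * ((d - 1 : ℕ) : ℝ) ≤ -(13 / 12) + 2 * ((d : ℝ) - 1) * δ := by
  have hd' : (4 : ℝ) ≤ d := by exact_mod_cast hd
  rw [Nat.cast_sub (by omega), Nat.cast_one]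
  nlinarith

end Exponents

section Numerics

variable {d : ℕ} {x : ℝ}

/-- Until time `e ^ 2 * x ^ (4 / 9 - 2 * A)` the relative velocity changes by a small fraction of
`x ^ (-5 / 18)`: the fluctuation bound of the better set accounts for the first term, the
reaction of the tagged particle on the background particle for the second. -/
theorem slow_velocity_change_le {A B D e : ℝ} (hx1 : 1 ≤ x) (hA0 : 0 < A) (he0 : 0 < e)
    (he1 : e ≤ 1) (hD0 : 0 ≤ D) (hB0 : 0 ≤ B) (heDB : (D + B) * e ≤ 1 / 20) :
    ∀ u ∈ Set.Icc 0 (e ^ 2 * x ^ (4 / 9 - 2 * A)),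
      D * (Real.sqrt (u / x) * x ^ A) + x⁻¹ * B * u ≤ x ^ (-(5 / 18) : ℝ) / 10 := by
  intro u hu
  have hx0 : 0 < x := by linarith
  have hpow : 0 < x ^ (-(5 / 18) : ℝ) := by positivity
  have hdiv : u / x ≤ e ^ 2 * x ^ (-(5 / 9) - 2 * A) := by
    rw [div_le_iff₀ hx0]
    refine hu.2.trans_eq ?_
    rw [mul_assoc, ← Real.rpow_add_one hx0.ne']
    congr 2; ring
  have hsqrt : Real.sqrt (u / x) ≤ e * x ^ (-(5 / 18) - A) := by
    refine Real.sqrt_le_iff.2 ⟨by positivity, hdiv.trans_eq ?_⟩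
    rw [mul_pow, sq (x ^ _), ← Real.rpow_add hx0]
    congr 2; ring
  have h1 : Real.sqrt (u / x) * x ^ A ≤ e * x ^ (-(5 / 18) : ℝ) := by
    calc _ ≤ e * x ^ (-(5 / 18) - A) * x ^ A := by gcongr
      _ = _ := by rw [mul_assoc, ← Real.rpow_add hx0, sub_add_cancel]
  have h2 : u / x ≤ e * x ^ (-(5 / 18) : ℝ) := by
    refine hdiv.trans ?_
    have : e ^ 2 ≤ e := by rw [sq]; exact mul_le_of_le_one_left he0.le he1
    have h3 : x ^ (-(5 / 9) - 2 * A) ≤ x ^ (-(5 / 18) : ℝ) :=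
      Real.rpow_le_rpow_of_exponent_le hx1 (by linarith)
    gcongr
  calc _ = D * (Real.sqrt (u / x) * x ^ A) + B * (u / x) := by ring
    _ ≤ D * (e * x ^ (-(5 / 18) : ℝ)) + B * (e * x ^ (-(5 / 18) : ℝ)) := by gcongr
    _ = ((D + B) * e) * x ^ (-(5 / 18) : ℝ) := by ring
    _ ≤ 1 / 20 * x ^ (-(5 / 18) : ℝ) := by gcongr
    _ ≤ _ := by linarith

/-- Until time `x ^ (5 / 9)` the relative velocity changes by at most `1 / 10`. -/
theorem fast_velocity_change_le {A B D : ℝ} (hx1 : 1 ≤ x)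
    (hD1 : 20 * D ≤ x ^ (2 / 9 - A)) (hB1 : 20 * B ≤ x ^ (4 / 9 : ℝ)) :
    ∀ u ∈ Set.Icc 0 (x ^ (5 / 9 : ℝ)),
      D * (Real.sqrt (u / x) * x ^ A) + x⁻¹ * B * u ≤ 1 / 10 := by
  intro u hu
  have hx0 : 0 < x := by linarith
  have hu0 : 0 ≤ u / x := div_nonneg hu.1 hx0.le
  have hdiv : u / x ≤ x ^ (-(4 / 9) : ℝ) := by
    rw [div_le_iff₀ hx0]
    refine hu.2.trans_eq ?_
    rw [← Real.rpow_add_one hx0.ne']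
    norm_num
  have hsqrt : Real.sqrt (u / x) ≤ x ^ (-(2 / 9) : ℝ) := by
    refine Real.sqrt_le_iff.2 ⟨by positivity, hdiv.trans_eq ?_⟩
    rw [sq, ← Real.rpow_add hx0]; norm_num
  have h1 : D * (Real.sqrt (u / x) * x ^ A) ≤ 1 / 20 := by
    calc _ ≤ x ^ (2 / 9 - A) / 20 * (x ^ (-(2 / 9) : ℝ) * x ^ A) := by
          gcongr; linarith
      _ = 1 / 20 := by
          rw [← Real.rpow_add hx0, div_mul_eq_mul_div, ← Real.rpow_add hx0,
            show 2 / 9 - A + (-(2 / 9) + A) = 0 by ring, Real.rpow_zero]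
  have h2 : B * (u / x) ≤ 1 / 20 := by
    calc _ ≤ x ^ (4 / 9 : ℝ) / 20 * x ^ (-(4 / 9) : ℝ) := by
          gcongr; linarith
      _ = 1 / 20 := by
          rw [div_mul_eq_mul_div, ← Real.rpow_add hx0, add_neg_cancel, Real.rpow_zero]
  calc _ = D * (Real.sqrt (u / x) * x ^ A) + B * (u / x) := by ring
    _ ≤ _ := by linarith

/-- The value of `2 h⁻¹ a ^ (-(d - 1))` for the step `h = R / 2` and the delay `a = τ₀ / 2`. -/
theorem slow_grid_le {R e δ : ℝ} (hd : 4 ≤ d) (hx1 : 1 ≤ x) (he0 : 0 < e) (hR : 0 < R) :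
    2 * (R / 2)⁻¹ * ((e ^ 2 * x ^ (4 / 9 - 2 * alphaStar d δ) / 2) ^ (d - 1))⁻¹ ≤
      4 / R * (2 / e ^ 2) ^ (d - 1) * x ^ (-(13 / 12) + 2 * ((d : ℝ) - 1) * δ) := by
  have hx0 : 0 < x := by linarith
  have h1 : ((e ^ 2 * x ^ (4 / 9 - 2 * alphaStar d δ) / 2) ^ (d - 1))⁻¹ =
      (2 / e ^ 2) ^ (d - 1) * x ^ (-(4 / 9 - 2 * alphaStar d δ) * ((d - 1 : ℕ) : ℝ)) := by
    rw [Real.rpow_mul_natCast hx0.le, Real.rpow_neg hx0.le, ← mul_pow, ← inv_pow]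
    congr 1
    have := (Real.rpow_pos_of_pos hx0 (4 / 9 - 2 * alphaStar d δ)).ne'
    field_simp
  rw [h1]
  calc _ = 4 / R * (2 / e ^ 2) ^ (d - 1) *
        x ^ (-(4 / 9 - 2 * alphaStar d δ) * ((d - 1 : ℕ) : ℝ)) := by
          rw [inv_div]; ring
    _ ≤ _ := by
        exact mul_le_mul_of_nonneg_left
          (Real.rpow_le_rpow_of_exponent_le hx1 (slow_exponent_le hd)) (by positivity)

/-- The value of `2 h⁻¹ a ^ (-(d - 1))` for the step `h = R / (2 x ^ (1/2))` and the delay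
`a = x ^ (5/9) / 2`. -/
theorem fast_grid_le {R δ : ℝ} (hd : 4 ≤ d) (hδ : 0 < δ) (hx1 : 1 ≤ x) (hR : 0 < R) :
    2 * (R / (2 * x ^ (1 / 2 : ℝ)))⁻¹ * ((x ^ (5 / 9 : ℝ) / 2) ^ (d - 1))⁻¹ ≤
      4 / R * 2 ^ (d - 1) * x ^ (-(13 / 12) + 2 * ((d : ℝ) - 1) * δ) := by
  have hx0 : 0 < x := by linarith
  have h1 : ((x ^ (5 / 9 : ℝ) / 2) ^ (d - 1))⁻¹ =
      2 ^ (d - 1) * x ^ (-(5 / 9) * ((d - 1 : ℕ) : ℝ)) := by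
    rw [Real.rpow_mul_natCast hx0.le, Real.rpow_neg hx0.le, ← mul_pow, ← inv_pow]
    congr 1
    rw [inv_div, div_eq_mul_inv]
  rw [h1]
  calc _ = 4 / R * 2 ^ (d - 1) *
        (x ^ (1 / 2 : ℝ) * x ^ (-(5 / 9) * ((d - 1 : ℕ) : ℝ))) := by
          rw [inv_div]; ring
    _ ≤ _ := by
        rw [← Real.rpow_add hx0]
        exact mul_le_mul_of_nonneg_left
          (Real.rpow_le_rpow_of_exponent_le hx1 (fast_exponent_le hd hδ)) (by positivity)

end Numerics

/-! ### The union bound -/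

section Probability

variable {d N : ℕ} {η R : ℝ} {Φ : E d → ℝ}

/-- The union bound over the dyadic scales and the two directions of time. -/
theorem hatMeasure_biUnion_le (hd : 2 ≤ d) (hR : 0 < R) (hΦ : ContDiff ℝ 3 Φ)
    (hsupp : Function.support Φ ⊆ Metric.closedBall 0 R) (hRL : R < halfSide N η)
    (hN : 0 < N) {b : ℝ} (hb : ∀ y, |Φ y| ≤ b) (n : ℕ) (T : ℕ → ℝ → ℝ) {h₁ a₁ h₂ a₂ : ℝ}
    (hh₁ : 0 < h₁) (ha₁ : 0 < a₁) (hh₂ : 0 < h₂) (ha₂ : 0 < a₂) :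
    hatMeasure N η Φ (⋃ k ∈ Finset.range n, ⋃ ε ∈ ({1, -1} : Finset ℝ),
        ({ω | flow N η Φ ω.2 (T k ε) ∈ freeRecollision N η R Φ ε h₁ a₁ ω.1} ∪
          {ω | flow N η Φ ω.2 (T k ε) ∈ freeRecollision N η R Φ ε h₂ a₂ ω.1})) ≤
      ENNReal.ofReal (Real.exp b) * (3 ^ d * volume (Metric.closedBall (0 : E d) (10 * R))) *
        volume (Metric.closedBall (0 : E d) (2 * R)) *
        ENNReal.ofReal (n * (2 * (2 * h₁⁻¹ * (a₁ ^ (d - 1))⁻¹ + 2 * h₂⁻¹ * (a₂ ^ (d - 1))⁻¹))) := by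
  set C := ENNReal.ofReal (Real.exp b) * (3 ^ d * volume (Metric.closedBall (0 : E d) (10 * R))) *
    volume (Metric.closedBall (0 : E d) (2 * R)) with hC
  have key : ∀ {ε h a : ℝ}, |ε| = 1 → 0 < h → 0 < a → ∀ t,
      hatMeasure N η Φ {ω | flow N η Φ ω.2 t ∈ freeRecollision N η R Φ ε h a ω.1} ≤
        C * ENNReal.ofReal (2 * h⁻¹ * (a ^ (d - 1))⁻¹) := by
    intro ε h a hε hh ha t
    rw [hatMeasure_preimage_flow hR hΦ hsupp hRL t
      (measurableSet_freeRecollision hR hΦ hsupp hRL ε h a)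
      (latticeHom_add_mem_freeRecollision hR hΦ hsupp hRL ε h a)]
    exact hatMeasure_freeRecollision_le hd hR hΦ hsupp hRL hN hb hε hh ha
  have hε : ∀ ε ∈ ({1, -1} : Finset ℝ), |ε| = 1 := by
    intro ε hε
    rcases (by simpa using hε : ε = 1 ∨ ε = -1) with rfl | rfl <;> simp
  have hcard : ({1, -1} : Finset ℝ).card = 2 := Finset.card_pair (by norm_num)
  set o₁ := 2 * h₁⁻¹ * (a₁ ^ (d - 1))⁻¹ with ho₁
  set o₂ := 2 * h₂⁻¹ * (a₂ ^ (d - 1))⁻¹ with ho₂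
  have ho₁0 : 0 ≤ o₁ := by positivity
  have ho₂0 : 0 ≤ o₂ := by positivity
  calc _ ≤ ∑ k ∈ Finset.range n, ∑ ε ∈ ({1, -1} : Finset ℝ),
        C * ENNReal.ofReal (o₁ + o₂) := by
        refine (measure_biUnion_finset_le _ _).trans (Finset.sum_le_sum fun k _ => ?_)
        refine (measure_biUnion_finset_le _ _).trans (Finset.sum_le_sum fun ε hεm => ?_)
        refine (measure_union_le _ _).trans ?_
        rw [ENNReal.ofReal_add ho₁0 ho₂0, mul_add]
        exact add_le_add (key (hε ε hεm) hh₁ ha₁ _) (key (hε ε hεm) hh₂ ha₂ _)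
    _ = _ := by
        rw [Finset.sum_const, Finset.sum_const, Finset.card_range, hcard,
          ENNReal.ofReal_mul (Nat.cast_nonneg n), ENNReal.ofReal_mul zero_le_two,
          ENNReal.ofReal_natCast, nsmul_eq_mul, nsmul_eq_mul]
        simp only [ENNReal.ofReal_ofNat, Nat.cast_ofNat]
        ring

end Probability

end TaggedParticle

theorem proposition4p8 (d : ℕ) (hd : 4 ≤ d) (R : ℝ) (hR : 0 < R) (Φ : E d → ℝ)
    (hΦ : ContDiff ℝ 3 Φ) (hsupp : Function.support Φ ⊆ Metric.closedBall 0 R)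
    (heven : ∀ x, Φ (-x) = Φ x) (Cint K : ℝ) :
    ∃ δ₀ : ℝ, 0 < δ₀ ∧ ∃ C : ℝ, 0 < C ∧
      ∀ η : ℝ, 2 ≤ η → ∀ δ : ℝ, 0 < δ → δ < δ₀ →
        -(19 / 18) + 2 * ((d : ℝ) - 1) * δ < -1 ∧
        ∃ N₀ : ℕ, ∀ M : ℕ → ℝ, (∀ n, 0 ≤ M n) → ∀ N : ℕ, N₀ ≤ N →
          ∀ t ∈ Set.Icc (-(N : ℝ)) N,
            hatMeasure N η Φ
                (betterSet N η R Φ Cint K (M N) δ (alphaStar d δ) (betaStar d δ) ∩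
                  (recollision N η R Φ t ∩ fastAt N η Φ ((N : ℝ) ^ (-gammaR)) t))
              ≤ ENNReal.ofReal (C * (N : ℝ) ^ (-(19 / 18) + 2 * ((d : ℝ) - 1) * δ)) := by
  have hd' : (4 : ℝ) ≤ d := by exact_mod_cast hd
  obtain ⟨b, -, hb⟩ := exists_abs_potential_le hΦ hsupp
  obtain ⟨B, hB0, hB⟩ := exists_norm_gradient_le hΦ hsupp
  set D : ℝ := d * |K| with hD
  have hD0 : 0 ≤ D := by positivity
  -- `e` makes the velocity change before time `τ₀` smaller than a tenth of `N ^ (-5 / 18)`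
  set e : ℝ := 1 / (20 * (D + B + 1)) with he
  have he0 : 0 < e := by positivity
  have he1 : e ≤ 1 := by
    rw [he, div_le_one (by positivity)]; linarith
  have heDB : (D + B) * e ≤ 1 / 20 := by
    rw [he, mul_one_div, div_le_div_iff₀ (by positivity) (by norm_num)]; linarith
  set C₁ : ℝ≥0∞ := ENNReal.ofReal (Real.exp b) *
    (3 ^ d * volume (Metric.closedBall (0 : E d) (10 * R))) *
      volume (Metric.closedBall (0 : E d) (2 * R)) with hC₁
  have hC₁top : C₁ ≠ ⊤ := by
    have h1 := (measure_closedBall_lt_top (μ := (volume : Measure (E d))) (x := 0)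
      (r := 10 * R)).ne
    have h2 := (measure_closedBall_lt_top (μ := (volume : Measure (E d))) (x := 0)
      (r := 2 * R)).ne
    exact ENNReal.mul_ne_top (ENNReal.mul_ne_top ENNReal.ofReal_ne_top
      (ENNReal.mul_ne_top (by finiteness) h1)) h2
  set C₂ : ℝ := 2 * (4 / R * (2 / e ^ 2) ^ (d - 1) + 4 / R * 2 ^ (d - 1)) with hC₂
  have hC₂0 : 0 < C₂ := by positivity
  -- `δ₀ = 1 / (72 d)` ensures `2 (d - 1) δ < 1 / 18` and `5 / 9 ≤ β*`
  refine ⟨1 / (72 * d), by positivity, C₁.toReal * C₂ + 1, by positivity, ?_⟩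
  intro η hη δ hδ hδ₀
  have hδd : d * δ < 1 / 72 := by
    rw [lt_div_iff₀ (by positivity)] at hδ₀; linarith
  have h4δ : 4 * δ ≤ d * δ := mul_le_mul_of_nonneg_right hd' hδ.le
  have hδ1 : δ < 1 / 288 := by linarith
  refine ⟨by linarith, ?_⟩
  set A := alphaStar d δ with hA
  have hA0 : 0 < A := alphaStar_pos hδ
  have hA1 : A ≤ 1 / 24 + δ := by
    have := one_div_four_mul_le hd
    rw [hA, alphaStar]; linarith
  have hev := (eventually_le_natCast_rpow (11 * R + 5) (by norm_num : (0 : ℝ) < 1 / 2)).and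
    ((eventually_le_natCast_rpow (20 * D) (by linarith : (0 : ℝ) < 2 / 9 - A)).and
    ((eventually_le_natCast_rpow (20 * B) (by norm_num : (0 : ℝ) < 4 / 9)).and
    ((eventually_le_natCast_rpow (8 * R / e ^ 2) (by linarith : (0 : ℝ) < 1 / 6 - 2 * A)).and
    ((eventually_le_natCast_rpow (8 * R) (by norm_num : (0 : ℝ) < 5 / 18)).and
    ((eventually_natLog_le_rpow (by norm_num : (0 : ℝ) < 1 / 36)).and
    (Filter.eventually_ge_atTop 1))))))
  obtain ⟨N₀, hN₀⟩ := Filter.eventually_atTop.1 hev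
  refine ⟨N₀, fun M _ N hNN t ht => ?_⟩
  obtain ⟨hR1, hD1, hB1, hτ1, hT1, hlog, hN⟩ := hN₀ N hNN
  have hx1 : (1 : ℝ) ≤ N := by exact_mod_cast hN
  have hx0 : (0 : ℝ) < N := by linarith
  have hle : ∀ {p q : ℝ}, p ≤ q → (N : ℝ) ^ p ≤ (N : ℝ) ^ q :=
    fun h => Real.rpow_le_rpow_of_exponent_le hx1 h
  have hadd : ∀ p q : ℝ, (N : ℝ) ^ p * (N : ℝ) ^ q = (N : ℝ) ^ (p + q) :=
    fun p q => (Real.rpow_add hx0 p q).symm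
  have hpow : ∀ p : ℝ, 0 < (N : ℝ) ^ p := fun p => Real.rpow_pos_of_pos hx0 p
  have hg : (N : ℝ) ^ (-gammaR) = (N : ℝ) ^ (-(5 / 18) : ℝ) := by rw [gammaR]; norm_num
  have hginv : ((N : ℝ) ^ (-gammaR))⁻¹ = (N : ℝ) ^ (5 / 18 : ℝ) := by
    rw [hg, Real.rpow_neg hx0.le, inv_inv]
  have hq18 : 1 ≤ (N : ℝ) ^ (5 / 18 : ℝ) := Real.one_le_rpow hx1 (by norm_num)
  have hN1 : (N : ℝ) ^ (1 : ℝ) = N := Real.rpow_one _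
  -- there is no displacement around the torus before time `2 N`
  have hq1 : 1 ≤ (N : ℝ) ^ (1 / 2 : ℝ) := Real.one_le_rpow hx1 (by norm_num)
  have hside : (N : ℝ) ^ (2 : ℝ) ≤ halfSide N η := hle hη
  have hwrap : R + 2 * (N : ℝ) ^ (1 / 2 : ℝ) * (2 * N) < halfSide N η := by
    refine lt_of_lt_of_le ?_ hside
    have h1 : (N : ℝ) ^ (2 : ℝ) = (N : ℝ) ^ (1 / 2 : ℝ) * ((N : ℝ) ^ (1 / 2 : ℝ) * N) := by
      rw [← mul_assoc, hadd]
      norm_num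
      ring
    have h2 : 1 ≤ (N : ℝ) ^ (1 / 2 : ℝ) * N := one_le_mul_of_one_le_of_one_le hq1 hx1
    have h3 := mul_le_mul_of_nonneg_right hR1 (zero_le_one.trans h2)
    have h4 := mul_le_mul_of_nonneg_left h2 hR.le
    rw [h1]
    linarith
  have h10 : 10 * R < halfSide N η := by
    refine lt_of_lt_of_le ?_ hside
    have := hle (show (1 / 2 : ℝ) ≤ 2 by norm_num)
    linarith
  have hRL : R < halfSide N η := by linarith
  -- the times `τ₀` and `T` before which slow and fast particles cannot recollide
  set τ₀ := e ^ 2 * (N : ℝ) ^ (4 / 9 - 2 * A) with hτ₀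
  set T := (N : ℝ) ^ (5 / 9 : ℝ) with hT
  have hslow := slow_velocity_change_le hx1 (A := A) hA0 he0 he1 hD0 hB0 heDB
  have hfast := fast_velocity_change_le hx1 (A := A) hD1 hB1
  simp only [hD, mul_assoc (d : ℝ)] at hslow hfast
  rw [← hg] at hslow
  have hτ2 : 3 * R / (N : ℝ) ^ (-gammaR) + R / 2 ≤ τ₀ / 2 := by
    have h1 : (N : ℝ) ^ (4 / 9 - 2 * A) = (N : ℝ) ^ (5 / 18 : ℝ) * (N : ℝ) ^ (1 / 6 - 2 * A) := by
      rw [hadd]; congr 1; ring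
    have h2 : 8 * R ≤ e ^ 2 * (N : ℝ) ^ (1 / 6 - 2 * A) := by
      rw [div_le_iff₀ (by positivity)] at hτ1; linarith
    have h3 := mul_le_mul_of_nonneg_right h2 (zero_le_one.trans hq18)
    have h4 := mul_le_mul_of_nonneg_left hq18 hR.le
    rw [div_eq_mul_inv, hginv, hτ₀, h1]
    linarith
  have hT2 : 3 * R / (N : ℝ) ^ (-gammaR) + R ≤ T / 2 := by
    have h1 : T = (N : ℝ) ^ (5 / 18 : ℝ) * (N : ℝ) ^ (5 / 18 : ℝ) := by
      rw [hT, hadd]; norm_num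
    have h3 := mul_le_mul_of_nonneg_right hT1 (zero_le_one.trans hq18)
    have h4 := mul_le_mul_of_nonneg_left hq18 hR.le
    rw [div_eq_mul_inv, hginv, h1]
    linarith
  have hτT : τ₀ ≤ T := by
    have : e ^ 2 ≤ 1 := pow_le_one₀ he0.le he1
    calc τ₀ ≤ 1 * (N : ℝ) ^ (4 / 9 - 2 * A) := by rw [hτ₀]; gcongr
      _ ≤ T := by rw [one_mul]; exact hle (by linarith)
  have hTN : T ≤ N := by
    calc T ≤ (N : ℝ) ^ (1 : ℝ) := hle (by norm_num)
      _ = N := hN1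
  have hTβ : T ≤ (N : ℝ) ^ betaStar d δ := hle (five_ninths_le_betaStar hd (by linarith))
  have hgN : (N : ℝ) ^ (1 / 2 : ℝ) ≤ (N : ℝ) ^ (-gammaR) * N := by
    calc _ ≤ (N : ℝ) ^ (-(5 / 18) + 1 : ℝ) := hle (by norm_num)
      _ = _ := by rw [← hadd, hN1, hg]
  have hcover := recollision_subset (Cint := Cint) (K := K) (m := M N) (δ := δ) (α := A)
    (β := betaStar d δ) (by omega) hR hΦ hsupp hN hB (hpow _) hwrap h10 hslow hfast hτ2 hT2 hτT
    hTN hTβ hgN ht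
  refine (measure_mono hcover).trans ((hatMeasure_biUnion_le (by omega) hR hΦ hsupp hRL hN hb _ _
    (by positivity) (by positivity) (by positivity) (by positivity)).trans ?_)
  -- collecting the powers of `N`
  set p := -(13 / 12) + 2 * ((d : ℝ) - 1) * δ with hp
  have ho₁ := slow_grid_le (δ := δ) hd hx1 he0 hR
  have ho₂ := fast_grid_le hd hδ hx1 hR
  rw [← hC₁]
  nth_rewrite 1 [← ENNReal.ofReal_toReal hC₁top]
  rw [← ENNReal.ofReal_mul ENNReal.toReal_nonneg]
  refine ENNReal.ofReal_le_ofReal ?_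
  have hexp : (N : ℝ) ^ (1 / 36 : ℝ) * (N : ℝ) ^ p =
      (N : ℝ) ^ (-(19 / 18) + 2 * ((d : ℝ) - 1) * δ) := by
    rw [hadd, hp]; congr 1; ring
  calc _ ≤ C₁.toReal * ((N : ℝ) ^ (1 / 36 : ℝ) *
        (2 * (4 / R * (2 / e ^ 2) ^ (d - 1) * (N : ℝ) ^ p +
          4 / R * 2 ^ (d - 1) * (N : ℝ) ^ p))) := by gcongr
    _ = C₁.toReal * C₂ * ((N : ℝ) ^ (1 / 36 : ℝ) * (N : ℝ) ^ p) := by rw [hC₂]; ring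
    _ ≤ (C₁.toReal * C₂ + 1) * ((N : ℝ) ^ (1 / 36 : ℝ) * (N : ℝ) ^ p) := by
        gcongr; linarith
    _ = _ := by rw [hexp]
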